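/- A piston of mass $M=\varepsilon^{-2}$ moves without friction in a container $[0,L]$, $L>0$. To its left there are $m$ and to its right $n$ point particles of mass $1$. All bodies move freely except for elastic collisions of the particles with the container walls and with the piston; the particles do not interact with each other. Let $X$ be the position of the piston and $P=M\dot X$ its momentum, let $x_{l,i}\in[0,X]$, $p_{l,i}$ ($i\le m$) and $x_{r,j}\in[X,L]$, $p_{r,j}$ ($j\le n$) be the positions and momenta of the particles (positions are distances from the left wall, the thickness of the piston being subtracted), and let $$I_{l,i}=\frac{|p_{l,i}|\,X}{\pi},\qquad I_{r,j}=\frac{|p_{r,j}|\,(L-X)}{\pi}$$ be the action variables. A motion is considered as long as no two particles are in contact with the piston at the same moment. For all $m,n$, $L>0$, $T>0$, $a>0$ and $b$ there are $\varepsilon_0>0$ and $C>0$, depending only on these data, such that the following holds for every $0<\varepsilon<\varepsilon_0$ and every initial state with $0<X(0)<L$, $a\le X(0)\le L-a$, $|\varepsilon P(0)|\le b$, $a\le\sum_i p_{l,i}(0)^2\le b$ and $a\le\sum_j p_{r,j}(0)^2\le b$. Put $I_{\Sigma,l}^2=\sum_i I_{l,i}(0)^2$, $I_{\Sigma,r}^2=\sum_j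 I_{r,j}(0)^2$ (initial values of the actions, frozen) and $$H(P,X)=\varepsilon^2\frac{P^2}{2}+\frac{\pi^2 I_{\Sigma,l}^2}{2X^2}+\frac{\pi^2 I_{\Sigma,r}^2}{2(L-X)^2}.$$ The Hamiltonian system $\dot{\bar X}=\partial H/\partial P$, $\dot{\bar P}=-\partial H/\partial X$, evaluated at $(\bar P,\bar X)$, with $\bar X(0)=X(0)$, $\bar P(0)=P(0)$ has a solution with $0<\bar X<L$ on $[0,T/\varepsilon]$, and whenever $0\le s\le T/\varepsilon$, $(X,P,\dots)$ is a motion of the exact system on $[0,s]$ with the given initial state, and $(\bar P,\bar X)$ is such a solution on $[0,s]$, then $$|\varepsilon P(t)-\varepsilon\bar P(t)|\le C\varepsilon,\qquad |X(t)-\bar X(t)|\le C\varepsilon\qquad(0\le t\le s).$$ In particular ($m=n=1$) for one particle on each side the averaged Hamiltonian is $\varepsilon^2P^2/2+\pi^2I_l^2/(2X^2)+\pi^2I_r^2/(2(L-X)^2)$. -/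

import Mathlib

open Set Filter Topology

noncomputable section

/-- State of the container `[0, L]` with a massive piston at `X` (momentum `P`), `m` light particles
to the left of the piston and `n` to the right. Light particles have mass `1`, so their momenta are
their velocities. All positions are distances from the left wall; the thickness of the piston is
subtracted. -/
@[ext]
structure PistonState (m n : ℕ) where
  X : ℝ
  P : ℝ
  xl : Fin m → ℝ
  pl : Fin m → ℝ
  xr : Fin n → ℝ
  pr : Fin n → ℝ

namespace PistonState

variable {m n : ℕ}

/-- The particles are on their sides of the piston, inside the container. -/
def Admissible (L : ℝ) (z : PistonState m n) : Prop :=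
  0 < z.X ∧ z.X < L ∧ (∀ i, 0 ≤ z.xl i ∧ z.xl i ≤ z.X) ∧ (∀ j, z.X ≤ z.xr j ∧ z.xr j ≤ L)

/-- Free motion during time `u`; the piston has mass `M`, hence velocity `P / M`. -/
def free (M u : ℝ) (z : PistonState m n) : PistonState m n where
  X := z.X + u * (z.P / M)
  P := z.P
  xl := fun i => z.xl i + u * z.pl i
  pl := z.pl
  xr := fun j => z.xr j + u * z.pr j
  pr := z.pr

/-- Momentum transferred in an elastic collision from a body of mass `1` with velocity `v`
to a body of mass `M` with velocity `V`: the new velocities are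
`V' = V + 2 / (M + 1) * (v - V)` and `v' = 2 * V - v + 2 / (M + 1) * (v - V)`. -/
def transfer (M V v : ℝ) : ℝ := 2 * M / (M + 1) * (v - V)

/-- The left particle `i` is about to hit the piston. -/
def HitsLeft (M : ℝ) (z : PistonState m n) (i : Fin m) : Prop :=
  z.xl i = z.X ∧ z.P / M < z.pl i

/-- The right particle `j` is about to hit the piston. -/
def HitsRight (M : ℝ) (z : PistonState m n) (j : Fin n) : Prop :=
  z.xr j = z.X ∧ z.pr j < z.P / M

open Classical in
/-- The state just after the instant at which the state just before is `z`: elastic reflections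
from the two walls, and an elastic collision with the piston (used only when at most one particle
touches the piston). If nothing collides, the state is unchanged. -/
def impact (M L : ℝ) (z : PistonState m n) : PistonState m n where
  X := z.X
  P := z.P + (∑ i, if HitsLeft M z i then transfer M (z.P / M) (z.pl i) else 0)
        + ∑ j, if HitsRight M z j then transfer M (z.P / M) (z.pr j) else 0
  xl := z.xl
  pl := fun i =>
    if z.xl i = 0 ∧ z.pl i < 0 then -z.pl i
    else if HitsLeft M z i then z.pl i - transfer M (z.P / M) (z.pl i)
    else z.pl i
  xr := z.xr
  pr := fun j =>
    if z.xr j = L ∧ 0 < z.pr j then -z.pr j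
    else if HitsRight M z j then z.pr j - transfer M (z.P / M) (z.pr j)
    else z.pr j

/-- At most one particle touches the piston. -/
def AtMostOneContact (z : PistonState m n) : Prop :=
  {k : Fin m ⊕ Fin n | Sum.elim z.xl z.xr k = z.X}.Subsingleton

/-- `z` is a motion on the time interval `[0, s]` of the system of a piston of mass `M` and light
particles in `[0, L]`, without simultaneous collisions of two particles with the piston. At the
instant of a collision `z t` is the state prior to the collision. Each instant has a right and a
left neighbourhood in which the motion is free; hence there are finitely many collisions. -/
structure IsMotion (M L s : ℝ) (z : ℝ → PistonState m n) : Prop where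
  admissible : ∀ t ∈ Icc 0 s, (z t).Admissible L
  no_simultaneous : ∀ t ∈ Ico 0 s, (z t).AtMostOneContact
  after : ∀ t ∈ Ico 0 s, ∀ᶠ u in 𝓝[>] t, z u = ((z t).impact M L).free M (u - t)
  before : ∀ t ∈ Ioc 0 s, ∀ᶠ u in 𝓝[<] t, z t = (z u).free M (t - u)

/-- The action variable `|p| X / π` of a left particle. -/
def actionLeft (z : PistonState m n) (i : Fin m) : ℝ := |z.pl i| * z.X / Real.pi

/-- The action variable `|p| (L - X) / π` of a right particle. -/
def actionRight (L : ℝ) (z : PistonState m n) (j : Fin n) : ℝ :=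
  |z.pr j| * (L - z.X) / Real.pi

end PistonState

/-- The averaged Hamiltonian of the piston; `A` and `B` are the sums of the squared actions of the
left and of the right particles. -/
def averagedHamiltonian (ε L A B P X : ℝ) : ℝ :=
  ε ^ 2 * P ^ 2 / 2 + Real.pi ^ 2 * A / (2 * X ^ 2) + Real.pi ^ 2 * B / (2 * (L - X) ^ 2)

/-- `(P, X)` solves on `[0, s]` the Hamiltonian system `X' = ∂H/∂P`, `P' = -∂H/∂X` with the averaged
Hamiltonian and constant `A`, `B`, the piston staying strictly between the walls. -/
structure IsAveragedMotion (ε L A B s : ℝ) (P X : ℝ → ℝ) : Prop where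
  mem : ∀ t ∈ Icc 0 s, X t ∈ Ioo 0 L
  hasDeriv_X : ∀ t ∈ Icc 0 s,
    HasDerivWithinAt X (deriv (fun p => averagedHamiltonian ε L A B p (X t)) (P t)) (Icc 0 s) t
  hasDeriv_P : ∀ t ∈ Icc 0 s,
    HasDerivWithinAt P (-deriv (fun x => averagedHamiltonian ε L A B (P t) x) (X t)) (Icc 0 s) t

end

/-! Collisions are neither counted nor averaged over: two explicit functionals remove the fast
phases. (1) The corrected momentum `P + G`, with `G = virialLeft + virialRight`, weights the
momentum of a particle by `0` at its wall and by `1` at the piston. Wall reflections leave it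
unchanged and a hit only moves momentum from one term to another (`corrected_momentum_impact`). So
it is continuous, differs from `P` by `O(1)`, and has derivative `forceLeft - forceRight` in free
flight. (2) With `V = P / M`, the quantity `p X - x V` is constant in free flight and changes sign
when its own particle hits the wall or the piston. Its square is disturbed only by the jumps of `V`
due to other particles. The force of a left particle equals this square over `X ^ 3` up to `O(V)`
(`abs_force_sub_adiabatic_le`), and `V = O(ε)` by conservation of energy; the right side is
symmetric. The impulses of each side have a fixed sign, so the sum of all `|ΔP|` up to time `t` is
`O(1 + t)`. Each contributes to the invariants with a factor `1 / M = ε ^ 2`; over a time `T / ε`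
they drift by `O(ε)` (`IsMotion.abs_sub_le_of_impact`). Hence `(X, ε (P + G))` solves the averaged
system up to `O(ε ^ 2)`, and Grönwall's inequality over a time `T / ε` gives `O(ε)`
(`abs_sub_le_of_approx_solution`). Both pistons stay away from the walls: the exact one by the
almost invariants, the averaged one by its energy. -/

noncomputable section

/-! ### Induction along intervals and one-sided growth estimates. -/

/-- Induction along a real interval. -/
theorem forall_mem_Icc_of_forall_Ico {p : ℝ → Prop} {s : ℝ} (h0 : p 0)
    (hr : ∀ t ∈ Ico 0 s, (∀ r ∈ Icc 0 t, p r) → ∀ᶠ u in 𝓝[>] t, p u)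
    (hl : ∀ t ∈ Ioc 0 s, (∀ r ∈ Ico 0 t, p r) → p t) : ∀ t ∈ Icc 0 s, p t := by
  intro t₁ ht₁
  have hs : 0 ≤ s := ht₁.1.trans ht₁.2
  set A : Set ℝ := {t | t ∈ Icc 0 s ∧ ∀ r ∈ Icc 0 t, p r} with hA
  have h0A : (0 : ℝ) ∈ A := ⟨⟨le_rfl, hs⟩, fun r hr => by
    rw [show r = 0 from le_antisymm hr.2 hr.1]; exact h0⟩
  have hbdd : BddAbove A := ⟨s, fun t ht => ht.1.2⟩
  set τ := sSup A with hτ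
  have hτ0 : 0 ≤ τ := le_csSup hbdd h0A
  have hτs : τ ≤ s := csSup_le ⟨0, h0A⟩ fun t ht => ht.1.2
  have hlt : ∀ r ∈ Ico 0 τ, p r := by
    intro r hr
    obtain ⟨t, htA, hrt⟩ := exists_lt_of_lt_csSup ⟨0, h0A⟩ hr.2
    exact htA.2 r ⟨hr.1, hrt.le⟩
  have hpτ : p τ := by
    rcases hτ0.eq_or_lt with h | h
    · rw [← h]; exact h0
    · exact hl τ ⟨h, hτs⟩ hlt
  have hle : ∀ r ∈ Icc 0 τ, p r := by
    intro r hr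
    rcases hr.2.eq_or_lt with h | h
    · rw [h]; exact hpτ
    · exact hlt r ⟨hr.1, h⟩
  rcases hτs.eq_or_lt with h | h
  · exact hle t₁ ⟨ht₁.1, h ▸ ht₁.2⟩
  · exfalso
    obtain ⟨u, hu, hu'⟩ := mem_nhdsGT_iff_exists_Ioo_subset.1 (hr τ ⟨hτ0, h⟩ hle)
    have hu1 : τ < u := hu
    set w := min ((τ + u) / 2) s with hw
    have hτw : τ < w := lt_min (by linarith) h
    have hwu : w < u := (min_le_left _ _).trans_lt (by linarith)
    have hwA : w ∈ A := by
      refine ⟨⟨by linarith, min_le_right _ _⟩, fun r hr => ?_⟩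
      rcases le_or_gt r τ with h' | h'
      · exact hle r ⟨hr.1, h'⟩
      · exact hu' ⟨h', hr.2.trans_lt hwu⟩
    exact absurd (le_csSup hbdd hwA) (not_le.2 hτw)

/-- A function which locally, to the right and to the left of every point, grows with speed at most
`c` grows with speed at most `c`; downward jumps are allowed. -/
theorem le_add_mul_of_eventually {g : ℝ → ℝ} {s c : ℝ}
    (hr : ∀ t ∈ Ico 0 s, ∀ᶠ u in 𝓝[>] t, g u ≤ g t + c * (u - t))
    (hl : ∀ t ∈ Ioc 0 s, ∀ᶠ u in 𝓝[<] t, g t ≤ g u + c * (t - u)) :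
    ∀ t ∈ Icc 0 s, g t ≤ g 0 + c * t := by
  apply forall_mem_Icc_of_forall_Ico
  · simp
  · intro t ht h
    filter_upwards [hr t ht] with u hu
    have := h t ⟨ht.1, le_rfl⟩
    linarith
  · intro t ht h
    have h1 : ∀ᶠ u in 𝓝[<] t, u ∈ Ioo 0 t := Ioo_mem_nhdsLT ht.1
    obtain ⟨u, hu, hu'⟩ := ((hl t ht).and h1).exists
    have := h u ⟨hu'.1.le, hu'.2⟩
    linarith

/-! ### Growth, continuity and right derivatives of functionals along a motion. -/

namespace PistonState

variable {m n : ℕ}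

theorem free_free (M u v : ℝ) (z : PistonState m n) :
    (z.free M u).free M v = z.free M (u + v) := by
  ext <;> simp [free] <;> ring

theorem free_zero (M : ℝ) (z : PistonState m n) : z.free M 0 = z := by
  ext <;> simp [free]

variable {M L s : ℝ} {z : ℝ → PistonState m n}

theorem IsMotion.eq_free_left (h : IsMotion M L s z) {t : ℝ} (ht : t ∈ Ioc 0 s) :
    ∀ᶠ u in 𝓝[<] t, z u = (z t).free M (u - t) := by
  filter_upwards [h.before t ht] with u hu
  rw [hu, free_free, sub_add_sub_cancel', sub_self, free_zero]

theorem IsMotion.mono (h : IsMotion M L s z) {r : ℝ} (hr : r ≤ s) : IsMotion M L r z where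
  admissible t ht := h.admissible t ⟨ht.1, ht.2.trans hr⟩
  no_simultaneous t ht := h.no_simultaneous t ⟨ht.1, ht.2.trans_le hr⟩
  after t ht := h.after t ⟨ht.1, ht.2.trans_le hr⟩
  before t ht := h.before t ⟨ht.1, ht.2.trans hr⟩

theorem Admissible.impact {M L : ℝ} {z : PistonState m n} (h : z.Admissible L) :
    (z.impact M L).Admissible L := h

/-- A functional not increased by impacts, and of derivative below `c` in free flight, grows with
speed at most `c` along a motion. -/
theorem IsMotion.le_add_mul (h : IsMotion M L s z) {f : PistonState m n → ℝ} {c : ℝ}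
    (himp : ∀ t ∈ Ico 0 s, f ((z t).impact M L) ≤ f (z t))
    (hfree : ∀ t ∈ Icc 0 s, ∀ w : PistonState m n, w = z t ∨ t < s ∧ w = (z t).impact M L →
      ∃ d < c, HasDerivAt (fun u => f (w.free M u)) d 0) :
    ∀ t ∈ Icc 0 s, f (z t) ≤ f (z 0) + c * t := by
  have key : ∀ {t : ℝ} {w : PistonState m n} {d : ℝ}, d < c →
      HasDerivAt (fun u => f (w.free M u)) d 0 →
      HasDerivAt (fun u => f (w.free M (u - t)) - c * (u - t)) (d - c) t := by
    intro t w d hd hf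
    have h1 : HasDerivAt (fun u : ℝ => u - t) 1 t := (hasDerivAt_id t).sub_const t
    have h2 : HasDerivAt (fun u => f (w.free M u)) d (t - t) := by rwa [sub_self]
    simpa using (h2.comp_sub_const t t).fun_sub (h1.const_mul c)
  -- A strictly negative derivative fixes the sign of the slope on a whole punctured neighbourhood;
  -- this is why `d < c` is strict.
  have hslope : ∀ {φ : ℝ → ℝ} {d t : ℝ}, HasDerivAt φ d t → d < 0 →
      (∀ᶠ u in 𝓝[≠] t, slope φ t u < 0) := by
    intro φ d t hφ hd
    exact (hasDerivAt_iff_tendsto_slope.1 hφ).eventually (gt_mem_nhds hd)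
  apply le_add_mul_of_eventually (g := fun t => f (z t))
  · intro t ht
    obtain ⟨d, hd, hf⟩ := hfree t ⟨ht.1, ht.2.le⟩ _ (Or.inr ⟨ht.2, rfl⟩)
    have h1 := (hslope (key (t := t) hd hf) (sub_neg.2 hd)).filter_mono
      (nhdsWithin_mono t fun u (hu : t < u) => hu.ne')
    filter_upwards [h.after t ht, h1, self_mem_nhdsWithin] with u hu hs' (htu : t < u)
    rw [hu]
    rw [slope_def_field, div_neg_iff] at hs'
    rcases hs' with hs' | hs'
    · linarith [hs'.2]
    · simp only [sub_self, free_zero, mul_zero, sub_zero] at hs'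
      linarith [himp t ht, hs'.1]
  · intro t ht
    obtain ⟨d, hd, hf⟩ := hfree t ⟨ht.1.le, ht.2⟩ _ (Or.inl rfl)
    have h1 := (hslope (key (t := t) hd hf) (sub_neg.2 hd)).filter_mono
      (nhdsWithin_mono t fun u (hu : u < t) => hu.ne)
    filter_upwards [h.eq_free_left ht, h1, self_mem_nhdsWithin] with u hu hs' (htu : u < t)
    rw [hu]
    rw [slope_def_field, div_neg_iff] at hs'
    rcases hs' with hs' | hs'
    · simp only [sub_self, free_zero, mul_zero, sub_zero] at hs'
      linarith [hs'.1]
    · linarith [hs'.2]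

/-- A functional invariant under impacts and continuous in free flight is continuous along a
motion. -/
theorem IsMotion.continuousOn (h : IsMotion M L s z) {f : PistonState m n → ℝ}
    (himp : ∀ t ∈ Ico 0 s, f ((z t).impact M L) = f (z t))
    (hfree : ∀ w : PistonState m n, w.Admissible L → ContinuousAt (fun u => f (w.free M u)) 0) :
    ContinuousOn (fun t => f (z t)) (Icc 0 s) := by
  have key : ∀ {t : ℝ} {w : PistonState m n}, w.Admissible L →
      ContinuousAt (fun u => f (w.free M (u - t))) t := by
    intro t w hw
    have h2 : ContinuousAt (fun u => f (w.free M u)) (t - t) := by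
      rw [sub_self]; exact hfree w hw
    exact h2.comp (f := fun u : ℝ => u - t) (continuous_sub_right t).continuousAt
  intro t ht
  have hright : t < s → ContinuousWithinAt (fun t => f (z t)) (Ici t) t := by
    intro hts
    have h1 := (key (t := t) ((h.admissible t ht).impact (M := M))).continuousWithinAt (s := Ioi t)
    have h2 : ContinuousWithinAt (fun t => f (z t)) (Ioi t) t := by
      refine h1.congr_of_eventuallyEq ?_ ?_
      · filter_upwards [h.after t ⟨ht.1, hts⟩] with u hu
        rw [hu]
      · rw [sub_self, free_zero, himp t ⟨ht.1, hts⟩]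
    exact continuousWithinAt_Ioi_iff_Ici.1 h2
  have hleft : 0 < t → ContinuousWithinAt (fun t => f (z t)) (Iic t) t := by
    intro hts
    have h1 := (key (t := t) (h.admissible t ht)).continuousWithinAt (s := Iio t)
    have h2 : ContinuousWithinAt (fun t => f (z t)) (Iio t) t := by
      refine h1.congr_of_eventuallyEq ?_ ?_
      · filter_upwards [h.eq_free_left ⟨hts, ht.2⟩] with u hu
        rw [hu]
      · rw [sub_self, free_zero]
    exact continuousWithinAt_Iio_iff_Iic.1 h2
  rcases ht.1.eq_or_lt with h0 | h0
  · rcases ht.2.eq_or_lt with h1 | h1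
    · have : Icc 0 s = {t} := by rw [← h0, ← h1, ← h0]; simp
      rw [this]; exact continuousWithinAt_singleton
    · exact (hright h1).mono fun u hu => h0 ▸ hu.1
  · rcases ht.2.eq_or_lt with h1 | h1
    · exact (hleft h0).mono fun u hu => h1 ▸ hu.2
    · exact (continuousAt_iff_continuous_left_right.2 ⟨hleft h0, hright h1⟩).continuousWithinAt

/-- Right derivative along a motion of a functional invariant under impacts. -/
theorem IsMotion.hasDerivWithinAt (h : IsMotion M L s z) {f : PistonState m n → ℝ} {t d : ℝ}
    (ht : t ∈ Ico 0 s) (himp : f ((z t).impact M L) = f (z t))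
    (hfree : HasDerivAt (fun u => f (((z t).impact M L).free M u)) d 0) :
    HasDerivWithinAt (fun t => f (z t)) d (Ici t) t := by
  have h2 : HasDerivAt (fun u => f (((z t).impact M L).free M u)) d (t - t) := by rwa [sub_self]
  have h3 := (h2.comp_sub_const t t).hasDerivWithinAt (s := Ioi t)
  rw [← hasDerivWithinAt_Ioi_iff_Ici]
  refine h3.congr_of_eventuallyEq ?_ ?_
  · filter_upwards [h.after t ht] with u hu
    rw [hu]
  · simp [free_zero, himp]

end PistonState
end

/-! ### Energy, correctors and adiabatic invariants at impacts. -/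

noncomputable section

namespace PistonState

variable {m n : ℕ}

/-- Twice the energy. -/
def energy (M : ℝ) (z : PistonState m n) : ℝ :=
  z.P ^ 2 / M + ∑ i, z.pl i ^ 2 + ∑ j, z.pr j ^ 2

/-- The part of the corrector of the piston momentum which comes from the left particles. -/
def virialLeft (z : PistonState m n) : ℝ := ∑ i, z.pl i * z.xl i / z.X

/-- The part of the corrector of the piston momentum which comes from the right particles. -/
def virialRight (L : ℝ) (z : PistonState m n) : ℝ := ∑ j, z.pr j * (L - z.xr j) / (L - z.X)

/-- The sum of squares of the adiabatic invariants of the left particles, which are exact for a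
piston of constant velocity. -/
def adiabaticLeft (M : ℝ) (z : PistonState m n) : ℝ :=
  ∑ i, (z.pl i * z.X - z.xl i * (z.P / M)) ^ 2

/-- The sum of squares of the adiabatic invariants of the right particles. -/
def adiabaticRight (M L : ℝ) (z : PistonState m n) : ℝ :=
  ∑ j, (z.pr j * (L - z.X) - (L - z.xr j) * (z.P / M)) ^ 2

open Classical in
/-- The momentum given to the piston by the left particles at an impact. -/
def impulseLeft (M : ℝ) (z : PistonState m n) : ℝ :=
  ∑ i, if HitsLeft M z i then transfer M (z.P / M) (z.pl i) else 0

open Classical in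
/-- The momentum given to the piston by the right particles at an impact. -/
def impulseRight (M : ℝ) (z : PistonState m n) : ℝ :=
  ∑ j, if HitsRight M z j then transfer M (z.P / M) (z.pr j) else 0

variable {M L : ℝ} {z : PistonState m n}

theorem impact_P : (z.impact M L).P = z.P + z.impulseLeft M + z.impulseRight M := rfl

theorem impulseLeft_nonneg (hM : 0 < M) : 0 ≤ z.impulseLeft M := by
  refine Finset.sum_nonneg fun i _ => ?_
  split_ifs with h
  · have := sub_pos.2 h.2
    unfold transfer
    positivity
  · exact le_rfl

theorem impulseRight_nonpos (hM : 0 < M) : z.impulseRight M ≤ 0 := by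
  refine Finset.sum_nonpos fun i _ => ?_
  split_ifs with h
  · have := sub_neg.2 h.2
    unfold transfer
    exact mul_nonpos_of_nonneg_of_nonpos (by positivity) this.le
  · exact le_rfl

/-- The weight `xl / X` is `0` at the wall, which hides the reflection, and `1` at the piston, so
the sum loses exactly the momentum handed over. -/
theorem Admissible.virialLeft_impact (h : z.Admissible L) :
    (z.impact M L).virialLeft = z.virialLeft - z.impulseLeft M := by
  classical
  unfold virialLeft impulseLeft
  rw [← Finset.sum_sub_distrib]
  refine Finset.sum_congr rfl fun i _ => ?_
  have hX : z.X ≠ 0 := h.1.ne'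
  simp only [PistonState.impact]
  split_ifs with h1 h2 h2
  · exact absurd (h1.1.symm.trans h2.1) h.1.ne
  · simp [h1.1]
  · rw [h2.1]; field_simp
  · simp

theorem Admissible.virialRight_impact (h : z.Admissible L) :
    (z.impact M L).virialRight L = z.virialRight L - z.impulseRight M := by
  classical
  unfold virialRight impulseRight
  rw [← Finset.sum_sub_distrib]
  refine Finset.sum_congr rfl fun i _ => ?_
  have hX : L - z.X ≠ 0 := (sub_pos.2 h.2.1).ne'
  simp only [PistonState.impact]
  split_ifs with h1 h2 h2
  · exact absurd (h1.1.symm.trans h2.1) h.2.1.ne'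
  · simp [h1.1]
  · rw [h2.1]; field_simp
  · simp

/-- Total momentum with the corrector is unchanged by impacts. -/
theorem Admissible.corrected_momentum_impact (h : z.Admissible L) :
    (z.impact M L).P + ((z.impact M L).virialLeft + (z.impact M L).virialRight L) =
      z.P + (z.virialLeft + z.virialRight L) := by
  rw [h.virialLeft_impact, h.virialRight_impact, impact_P]; ring

/-- Left particles push only to the right and right particles only to the left, so the difference of
the two virials drops by the sum of the absolute impulses. This difference is bounded and grows at a
bounded rate in free flight away from the walls, which bounds the total impulse without counting
collisions. -/
theorem Admissible.abs_impact_P_sub_le (hM : 0 < M) (h : z.Admissible L) :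
    |(z.impact M L).P - z.P| ≤ (z.virialLeft - z.virialRight L) -
      ((z.impact M L).virialLeft - (z.impact M L).virialRight L) := by
  rw [h.virialLeft_impact, h.virialRight_impact, impact_P]
  have h1 := impulseLeft_nonneg (z := z) hM
  have h2 := impulseRight_nonpos (z := z) hM
  rw [abs_le]; constructor <;> linarith

/-- At an impact with at most one particle in contact with the piston, at most one hits it. -/
theorem AtMostOneContact.hits_cases (h : z.AtMostOneContact) :
    ((∀ i, ¬ HitsLeft M z i) ∧ ∀ j, ¬ HitsRight M z j) ∨
    (∃ i₀, (∀ i, HitsLeft M z i ↔ i = i₀) ∧ ∀ j, ¬ HitsRight M z j) ∨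
    (∃ j₀, (∀ i, ¬ HitsLeft M z i) ∧ ∀ j, HitsRight M z j ↔ j = j₀) := by
  by_cases hl : ∃ i, HitsLeft M z i
  · obtain ⟨i₀, h0⟩ := hl
    refine Or.inr (Or.inl ⟨i₀, fun i => ⟨fun hi => ?_, fun hi => hi ▸ h0⟩, fun j hj => ?_⟩)
    · exact Sum.inl_injective (h (x := Sum.inl i) hi.1 (y := Sum.inl i₀) h0.1)
    · exact absurd (h (x := Sum.inl i₀) h0.1 (y := Sum.inr j) hj.1) Sum.inl_ne_inr
  push Not at hl
  by_cases hr : ∃ j, HitsRight M z j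
  · obtain ⟨j₀, h0⟩ := hr
    refine Or.inr (Or.inr ⟨j₀, hl, fun j => ⟨fun hj => ?_, fun hj => hj ▸ h0⟩⟩)
    exact Sum.inr_injective (h (x := Sum.inr j) hj.1 (y := Sum.inr j₀) h0.1)
  · push Not at hr
    exact Or.inl ⟨hl, hr⟩

/-- The impulse enters the energy quadratically, so two simultaneous hits would leave a cross term;
hence the assumption of a single contact. -/
theorem Admissible.energy_impact (hM : 0 < M) (h : z.Admissible L) (h1 : z.AtMostOneContact) :
    (z.impact M L).energy M = z.energy M := by
  classical
  have hl : ∑ i, (z.impact M L).pl i ^ 2 = ∑ i, z.pl i ^ 2 +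
      ∑ i, if HitsLeft M z i then
        (z.pl i - transfer M (z.P / M) (z.pl i)) ^ 2 - z.pl i ^ 2 else 0 := by
    rw [← Finset.sum_add_distrib]
    refine Finset.sum_congr rfl fun i _ => ?_
    simp only [PistonState.impact]
    split_ifs with h1 h2 h2
    · exact absurd (h1.1.symm.trans h2.1) h.1.ne
    all_goals ring
  have hr : ∑ i, (z.impact M L).pr i ^ 2 = ∑ i, z.pr i ^ 2 +
      ∑ i, if HitsRight M z i then
        (z.pr i - transfer M (z.P / M) (z.pr i)) ^ 2 - z.pr i ^ 2 else 0 := by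
    rw [← Finset.sum_add_distrib]
    refine Finset.sum_congr rfl fun i _ => ?_
    simp only [PistonState.impact]
    split_ifs with h1 h2 h2
    · exact absurd (h1.1.symm.trans h2.1) h.2.1.ne'
    all_goals ring
  unfold energy
  rw [hl, hr, impact_P, impulseLeft, impulseRight]
  have hM1 : M + 1 ≠ 0 := by positivity
  rcases h1.hits_cases (M := M) with ⟨a, b⟩ | ⟨i₀, a, b⟩ | ⟨i₀, a, b⟩
  · simp [a, b]
  · simp only [a, b, if_false, Finset.sum_ite_eq', Finset.mem_univ, if_true,
      Finset.sum_const_zero, transfer]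
    field_simp
    ring
  · simp only [a, b, if_false, Finset.sum_ite_eq', Finset.mem_univ, if_true,
      Finset.sum_const_zero, transfer]
    field_simp
    ring

theorem abs_sq_sub_sq_le {L R q Y y U U' : ℝ} (hY : |Y| ≤ L) (hy : |y| ≤ L) (hq : |q| ≤ R)
    (hU : |U| ≤ R) (hU' : |U'| ≤ R) :
    |(q * Y - y * U') ^ 2 - (q * Y - y * U) ^ 2| ≤ 4 * R * L ^ 2 * |U' - U| := by
  have hL : 0 ≤ L := (abs_nonneg _).trans hY
  have hR : 0 ≤ R := (abs_nonneg _).trans hq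
  have e : (q * Y - y * U') ^ 2 - (q * Y - y * U) ^ 2 =
      -(y * (2 * (q * Y) - y * (U + U'))) * (U' - U) := by ring
  have h1 : |2 * (q * Y) - y * (U + U')| ≤ 4 * R * L := by
    calc |2 * (q * Y) - y * (U + U')| ≤ |2 * (q * Y)| + |y * (U + U')| := abs_sub _ _
      _ ≤ 2 * (|q| * |Y|) + |y| * (|U| + |U'|) := by
        rw [abs_mul, abs_mul, abs_mul, abs_two]; gcongr; exact abs_add_le _ _
      _ ≤ 2 * (R * L) + L * (R + R) := by gcongr
      _ = 4 * R * L := by ring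
  rw [e, abs_mul, abs_neg, abs_mul]
  calc |y| * |2 * (q * Y) - y * (U + U')| * |U' - U|
      ≤ L * (4 * R * L) * |U' - U| := by gcongr
    _ = _ := by ring

theorem abs_le_of_energy_le {R : ℝ} (hM : 0 < M) (hR : 0 ≤ R) (h : z.energy M ≤ R ^ 2) :
    (∀ i, |z.pl i| ≤ R) ∧ (∀ j, |z.pr j| ≤ R) ∧ z.P ^ 2 / M ≤ R ^ 2 := by
  have h0 : 0 ≤ z.P ^ 2 / M := by positivity
  have h1 : 0 ≤ ∑ i, z.pl i ^ 2 := by positivity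
  have h2 : 0 ≤ ∑ i, z.pr i ^ 2 := by positivity
  unfold energy at h
  refine ⟨fun i => abs_le_of_sq_le_sq ?_ hR, fun i => abs_le_of_sq_le_sq ?_ hR, by linarith⟩
  · have := Finset.single_le_sum (f := fun i => z.pl i ^ 2) (fun i _ => sq_nonneg _)
      (Finset.mem_univ i)
    linarith
  · have := Finset.single_le_sum (f := fun i => z.pr i ^ 2) (fun i _ => sq_nonneg _)
      (Finset.mem_univ i)
    linarith

theorem abs_velocity_le_of_energy_le {R : ℝ} (hM : 1 ≤ M) (hR : 0 ≤ R) (h : z.energy M ≤ R ^ 2) :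
    |z.P / M| ≤ R := by
  refine abs_le_of_sq_le_sq ?_ hR
  have h1 := (abs_le_of_energy_le (by positivity) hR h).2.2
  refine le_trans ?_ h1
  rw [div_pow]
  gcongr
  nlinarith

/-- At the wall the term is `p X`, at the piston it is `X (p - V)`; reflection and reversal of the
relative velocity only change its sign. The error comes from the particles that do not collide,
which feel the jump of `V`. -/
theorem Admissible.abs_adiabaticLeft_impact_sub_le {R : ℝ} (hM : 1 ≤ M) (hR : 0 ≤ R)
    (h : z.Admissible L) (h1 : z.AtMostOneContact) (hE : z.energy M ≤ R ^ 2) :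
    |(z.impact M L).adiabaticLeft M - z.adiabaticLeft M| ≤
      m * (4 * R * L ^ 2 * (|(z.impact M L).P - z.P| / M)) := by
  have hM0 : 0 < M := by linarith
  have hE' : (z.impact M L).energy M ≤ R ^ 2 := by rwa [h.energy_impact hM0 h1]
  have hV := abs_velocity_le_of_energy_le hM hR hE
  have hV' := abs_velocity_le_of_energy_le hM hR hE'
  have hp := (abs_le_of_energy_le hM0 hR hE).1
  have hd : |(z.impact M L).P - z.P| / M = |(z.impact M L).P / M - z.P / M| := by
    rw [← sub_div, abs_div, abs_of_pos hM0]
  unfold adiabaticLeft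
  rw [← Finset.sum_sub_distrib]
  refine (Finset.abs_sum_le_sum_abs _ _).trans ?_
  refine (Finset.sum_le_card_nsmul _ _ (4 * R * L ^ 2 * (|(z.impact M L).P - z.P| / M))
    fun i _ => ?_).trans (by simp)
  rw [hd]
  have hnn : 0 ≤ 4 * R * L ^ 2 * |(z.impact M L).P / M - z.P / M| := by positivity
  have hX : |z.X| ≤ L := by rw [abs_of_pos h.1]; exact h.2.1.le
  have hx : |z.xl i| ≤ L := by
    rw [abs_of_nonneg (h.2.2.1 i).1]; exact (h.2.2.1 i).2.trans h.2.1.le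
  have hgen := abs_sq_sub_sq_le hX hx (hp i) hV hV'
  by_cases hw : z.xl i = 0 ∧ z.pl i < 0
  · have e1 : (z.impact M L).pl i = -z.pl i := by simp [PistonState.impact, hw]
    have e2 : (z.impact M L).xl i = 0 := hw.1
    rw [e1, e2, hw.1, show (z.impact M L).X = z.X from rfl]
    refine (le_of_eq ?_).trans hnn
    rw [abs_eq_zero]; ring
  by_cases hh : HitsLeft M z i
  · have e1 : (z.impact M L).pl i = z.pl i - transfer M (z.P / M) (z.pl i) := by
      simp [PistonState.impact, hw, hh]
    have e2 : (z.impact M L).P = z.P + transfer M (z.P / M) (z.pl i) := by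
      rw [impact_P, impulseLeft, impulseRight]
      rcases h1.hits_cases (M := M) with ⟨a, b⟩ | ⟨i₀, a, b⟩ | ⟨i₀, a, b⟩
      · exact absurd hh (a i)
      · simp [a, b, (a i).1 hh]
      · exact absurd hh (a i)
    rw [e1, e2, show (z.impact M L).X = z.X from rfl, show (z.impact M L).xl i = z.xl i from rfl,
      hh.1, ← e2]
    refine (le_of_eq ?_).trans hnn
    rw [abs_eq_zero, sub_eq_zero, e2, transfer]
    have hM1 : M + 1 ≠ 0 := by positivity
    field_simp
    ring
  · have e1 : (z.impact M L).pl i = z.pl i := by simp [PistonState.impact, hw, hh]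
    rw [e1]
    exact hgen

theorem Admissible.abs_adiabaticRight_impact_sub_le {R : ℝ} (hM : 1 ≤ M) (hR : 0 ≤ R)
    (h : z.Admissible L) (h1 : z.AtMostOneContact) (hE : z.energy M ≤ R ^ 2) :
    |(z.impact M L).adiabaticRight M L - z.adiabaticRight M L| ≤
      n * (4 * R * L ^ 2 * (|(z.impact M L).P - z.P| / M)) := by
  have hM0 : 0 < M := by linarith
  have hE' : (z.impact M L).energy M ≤ R ^ 2 := by rwa [h.energy_impact hM0 h1]
  have hV := abs_velocity_le_of_energy_le hM hR hE
  have hV' := abs_velocity_le_of_energy_le hM hR hE'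
  have hp := (abs_le_of_energy_le hM0 hR hE).2.1
  have hd : |(z.impact M L).P - z.P| / M = |(z.impact M L).P / M - z.P / M| := by
    rw [← sub_div, abs_div, abs_of_pos hM0]
  unfold adiabaticRight
  rw [← Finset.sum_sub_distrib]
  refine (Finset.abs_sum_le_sum_abs _ _).trans ?_
  refine (Finset.sum_le_card_nsmul _ _ (4 * R * L ^ 2 * (|(z.impact M L).P - z.P| / M))
    fun i _ => ?_).trans (by simp)
  rw [hd]
  have hnn : 0 ≤ 4 * R * L ^ 2 * |(z.impact M L).P / M - z.P / M| := by positivity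
  have hX : |L - z.X| ≤ L := by rw [abs_of_pos (sub_pos.2 h.2.1)]; linarith [h.1]
  have hx : |L - z.xr i| ≤ L := by
    rw [abs_of_nonneg (sub_nonneg.2 (h.2.2.2 i).2)]; linarith [(h.2.2.2 i).1, h.1]
  have hgen := abs_sq_sub_sq_le hX hx (hp i) hV hV'
  by_cases hw : z.xr i = L ∧ 0 < z.pr i
  · have e1 : (z.impact M L).pr i = -z.pr i := by simp [PistonState.impact, hw]
    have e2 : (z.impact M L).xr i = L := hw.1
    rw [e1, e2, hw.1, show (z.impact M L).X = z.X from rfl]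
    refine (le_of_eq ?_).trans hnn
    rw [abs_eq_zero]; ring
  by_cases hh : HitsRight M z i
  · have e1 : (z.impact M L).pr i = z.pr i - transfer M (z.P / M) (z.pr i) := by
      simp [PistonState.impact, hw, hh]
    have e2 : (z.impact M L).P = z.P + transfer M (z.P / M) (z.pr i) := by
      rw [impact_P, impulseLeft, impulseRight]
      rcases h1.hits_cases (M := M) with ⟨a, b⟩ | ⟨i₀, a, b⟩ | ⟨i₀, a, b⟩
      · exact absurd hh (b i)
      · exact absurd hh (b i)
      · simp [a, b, (b i).1 hh]
    rw [e1, e2, show (z.impact M L).X = z.X from rfl, show (z.impact M L).xr i = z.xr i from rfl,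
      hh.1, ← e2]
    refine (le_of_eq ?_).trans hnn
    rw [abs_eq_zero, sub_eq_zero, e2, transfer]
    have hM1 : M + 1 ≠ 0 := by positivity
    field_simp
    ring
  · have e1 : (z.impact M L).pr i = z.pr i := by simp [PistonState.impact, hw, hh]
    rw [e1]
    exact hgen

/-! ### Free flight: exact invariants, forces and their bounds. -/

theorem energy_free (u : ℝ) : (z.free M u).energy M = z.energy M := rfl

/-- The rate of `p X - x V` is `p V - p V = 0`. -/
theorem adiabaticLeft_free (u : ℝ) : (z.free M u).adiabaticLeft M = z.adiabaticLeft M := by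
  unfold adiabaticLeft
  refine Finset.sum_congr rfl fun i _ => ?_
  simp only [free]; ring

theorem adiabaticRight_free (u : ℝ) :
    (z.free M u).adiabaticRight M L = z.adiabaticRight M L := by
  unfold adiabaticRight
  refine Finset.sum_congr rfl fun i _ => ?_
  simp only [free]; ring

/-- The rate of change of `virialLeft` in free flight. -/
def forceLeft (M : ℝ) (z : PistonState m n) : ℝ :=
  ∑ i, (z.pl i ^ 2 / z.X - z.pl i * z.xl i * (z.P / M) / z.X ^ 2)

/-- Minus the rate of change of `virialRight` in free flight. -/
def forceRight (M L : ℝ) (z : PistonState m n) : ℝ :=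
  ∑ j, (z.pr j ^ 2 / (L - z.X) - z.pr j * (L - z.xr j) * (z.P / M) / (L - z.X) ^ 2)

theorem Admissible.hasDerivAt_virialLeft (h : z.Admissible L) :
    HasDerivAt (fun u => (z.free M u).virialLeft) (z.forceLeft M) 0 := by
  unfold virialLeft forceLeft
  refine HasDerivAt.fun_sum fun i _ => ?_
  simp only [free]
  have hX : z.X ≠ 0 := h.1.ne'
  have h1 : HasDerivAt (fun u : ℝ => z.xl i + u * z.pl i) (z.pl i) 0 := by
    simpa using ((hasDerivAt_id (0 : ℝ)).mul_const (z.pl i)).const_add (z.xl i)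
  have h2 : HasDerivAt (fun u : ℝ => z.X + u * (z.P / M)) (z.P / M) 0 := by
    simpa using ((hasDerivAt_id (0 : ℝ)).mul_const (z.P / M)).const_add z.X
  refine ((h1.const_mul (z.pl i)).fun_div h2 (by simpa using hX)).congr_deriv ?_
  simp only [zero_mul, add_zero]
  field_simp

theorem Admissible.hasDerivAt_virialRight (h : z.Admissible L) :
    HasDerivAt (fun u => (z.free M u).virialRight L) (-z.forceRight M L) 0 := by
  unfold virialRight forceRight
  rw [← Finset.sum_neg_distrib]
  refine HasDerivAt.fun_sum fun i _ => ?_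
  simp only [free]
  have hX : L - z.X ≠ 0 := (sub_pos.2 h.2.1).ne'
  have h1 : HasDerivAt (fun u : ℝ => L - (z.xr i + u * z.pr i)) (-z.pr i) 0 := by
    simpa using (((hasDerivAt_id (0 : ℝ)).mul_const (z.pr i)).const_add (z.xr i)).const_sub L
  have h2 : HasDerivAt (fun u : ℝ => L - (z.X + u * (z.P / M))) (-(z.P / M)) 0 := by
    simpa using (((hasDerivAt_id (0 : ℝ)).mul_const (z.P / M)).const_add z.X).const_sub L
  refine ((h1.const_mul (z.pr i)).fun_div h2 (by simpa using hX)).congr_deriv ?_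
  simp only [zero_mul, add_zero]
  field_simp
  ring

theorem hasDerivAt_X : HasDerivAt (fun u => (z.free M u).X) (z.P / M) 0 := by
  simpa [free] using ((hasDerivAt_id (0 : ℝ)).mul_const (z.P / M)).const_add z.X

theorem hasDerivAt_P : HasDerivAt (fun u => (z.free M u).P) 0 0 := by
  simpa [free] using hasDerivAt_const (0 : ℝ) z.P

theorem abs_div_le_of_mem {R y Y q : ℝ} (hq : |q| ≤ R) (hy : 0 ≤ y) (hyY : y ≤ Y) (hY : 0 < Y) :
    |q * y / Y| ≤ R := by
  rw [mul_div_assoc, abs_mul, abs_of_nonneg (div_nonneg hy hY.le)]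
  calc |q| * (y / Y) ≤ |q| * 1 := by gcongr; exact (div_le_one hY).2 hyY
    _ ≤ R := by linarith

theorem Admissible.abs_virialLeft_le {R : ℝ} (h : z.Admissible L) (hp : ∀ i, |z.pl i| ≤ R) :
    |z.virialLeft| ≤ m * R := by
  refine (Finset.abs_sum_le_sum_abs _ _).trans ?_
  refine (Finset.sum_le_card_nsmul _ _ R fun i _ => ?_).trans (by simp)
  exact abs_div_le_of_mem (hp i) (h.2.2.1 i).1 (h.2.2.1 i).2 h.1

theorem Admissible.abs_virialRight_le {R : ℝ} (h : z.Admissible L) (hp : ∀ j, |z.pr j| ≤ R) :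
    |z.virialRight L| ≤ n * R := by
  refine (Finset.abs_sum_le_sum_abs _ _).trans ?_
  refine (Finset.sum_le_card_nsmul _ _ R fun i _ => ?_).trans (by simp)
  exact abs_div_le_of_mem (hp i) (sub_nonneg.2 (h.2.2.2 i).2) (by linarith [(h.2.2.2 i).1])
    (sub_pos.2 h.2.1)

theorem abs_force_term_le {R V y Y q δ : ℝ} (hδ : 0 < δ) (hq : |q| ≤ R) (hV : |V| ≤ R)
    (hy : 0 ≤ y) (hyY : y ≤ Y) (hY : δ ≤ Y) :
    |q ^ 2 / Y - q * y * V / Y ^ 2| ≤ 2 * R ^ 2 / δ := by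
  have hY0 : 0 < Y := hδ.trans_le hY
  have hR : 0 ≤ R := (abs_nonneg _).trans hq
  have e : q ^ 2 / Y - q * y * V / Y ^ 2 = (q * q - q * y / Y * V) / Y := by field_simp
  rw [e, abs_div, abs_of_pos hY0]
  gcongr
  calc |q * q - q * y / Y * V| ≤ |q * q| + |q * y / Y * V| := abs_sub _ _
    _ = |q| * |q| + |q * y / Y| * |V| := by rw [abs_mul, abs_mul (q * y / Y)]
    _ ≤ R * R + R * R := by gcongr; exact abs_div_le_of_mem hq hy hyY hY0
    _ = 2 * R ^ 2 := by ring

theorem Admissible.abs_forceLeft_le {R δ : ℝ} (h : z.Admissible L) (hδ : 0 < δ) (hX : δ ≤ z.X)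
    (hp : ∀ i, |z.pl i| ≤ R) (hV : |z.P / M| ≤ R) :
    |z.forceLeft M| ≤ m * (2 * R ^ 2 / δ) := by
  refine (Finset.abs_sum_le_sum_abs _ _).trans ?_
  refine (Finset.sum_le_card_nsmul _ _ (2 * R ^ 2 / δ) fun i _ => ?_).trans (by simp)
  exact abs_force_term_le hδ (hp i) hV (h.2.2.1 i).1 (h.2.2.1 i).2 hX

theorem Admissible.abs_forceRight_le {R δ : ℝ} (h : z.Admissible L) (hδ : 0 < δ)
    (hX : δ ≤ L - z.X) (hp : ∀ i, |z.pr i| ≤ R) (hV : |z.P / M| ≤ R) :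
    |z.forceRight M L| ≤ n * (2 * R ^ 2 / δ) := by
  refine (Finset.abs_sum_le_sum_abs _ _).trans ?_
  refine (Finset.sum_le_card_nsmul _ _ (2 * R ^ 2 / δ) fun i _ => ?_).trans (by simp)
  exact abs_force_term_le hδ (hp i) hV (sub_nonneg.2 (h.2.2.2 i).2)
    (by linarith [(h.2.2.2 i).1]) hX

end PistonState
end

/-! ### The averaged system: truncation, stability, confinement and existence. -/

noncomputable section

/-- The force on the piston in the averaged system, with `1 / x ^ 3` and `1 / (L - x) ^ 3` made
constant for `x ≤ δ` and for `L - x ≤ δ`. -/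
def truncatedForce (δ L α β x : ℝ) : ℝ :=
  α * (max δ x)⁻¹ ^ 3 - β * (max δ (L - x))⁻¹ ^ 3

/-- The truncation makes the force bounded and globally Lipschitz, and is inactive where the
trajectories turn out to stay. -/
theorem truncatedForce_eq {δ L α β x : ℝ} (h1 : δ ≤ x) (h2 : x ≤ L - δ) :
    truncatedForce δ L α β x = α / x ^ 3 - β / (L - x) ^ 3 := by
  rw [truncatedForce, max_eq_right h1, max_eq_right (by linarith)]
  simp [div_eq_mul_inv]

theorem abs_inv_max_cube_sub_le {δ x y : ℝ} (hδ : 0 < δ) :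
    |(max δ x)⁻¹ ^ 3 - (max δ y)⁻¹ ^ 3| ≤ 3 / δ ^ 4 * |x - y| := by
  set u := max δ x with hu
  set v := max δ y with hv
  have hu1 : δ ≤ u := le_max_left _ _
  have hv1 : δ ≤ v := le_max_left _ _
  have hu0 : 0 < u := hδ.trans_le hu1
  have hv0 : 0 < v := hδ.trans_le hv1
  have huv : |u - v| ≤ |x - y| := by
    have := abs_max_sub_max_le_max δ x δ y
    simpa using this
  have hui : u⁻¹ ≤ δ⁻¹ := inv_anti₀ hδ hu1
  have hvi : v⁻¹ ≤ δ⁻¹ := inv_anti₀ hδ hv1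
  have hui0 : 0 ≤ u⁻¹ := by positivity
  have hvi0 : 0 ≤ v⁻¹ := by positivity
  have e : u⁻¹ ^ 3 - v⁻¹ ^ 3 =
      -(u⁻¹ * v⁻¹ * (u⁻¹ ^ 2 + u⁻¹ * v⁻¹ + v⁻¹ ^ 2)) * (u - v) := by
    field_simp
    ring
  rw [e, abs_mul, abs_neg, abs_of_nonneg (by positivity)]
  calc u⁻¹ * v⁻¹ * (u⁻¹ ^ 2 + u⁻¹ * v⁻¹ + v⁻¹ ^ 2) * |u - v|
      ≤ δ⁻¹ * δ⁻¹ * (δ⁻¹ ^ 2 + δ⁻¹ * δ⁻¹ + δ⁻¹ ^ 2) * |x - y| := by gcongr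
    _ = 3 / δ ^ 4 * |x - y| := by field_simp; ring

theorem abs_truncatedForce_sub_le {δ L α β Γ x y : ℝ} (hδ : 0 < δ) (hα : 0 ≤ α) (hβ : 0 ≤ β)
    (hαΓ : α ≤ Γ) (hβΓ : β ≤ Γ) :
    |truncatedForce δ L α β x - truncatedForce δ L α β y| ≤ 6 * Γ / δ ^ 4 * |x - y| := by
  have h1 := abs_inv_max_cube_sub_le (x := x) (y := y) hδ
  have h2 := abs_inv_max_cube_sub_le (x := L - x) (y := L - y) hδ
  rw [sub_sub_sub_cancel_left, abs_sub_comm y x] at h2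
  have e : truncatedForce δ L α β x - truncatedForce δ L α β y =
    α * ((max δ x)⁻¹ ^ 3 - (max δ y)⁻¹ ^ 3) -
      β * ((max δ (L - x))⁻¹ ^ 3 - (max δ (L - y))⁻¹ ^ 3) := by
    unfold truncatedForce; ring
  have hΓ : 0 ≤ Γ := hα.trans hαΓ
  rw [e]
  refine (abs_sub _ _).trans ?_
  rw [abs_mul, abs_mul, abs_of_nonneg hα, abs_of_nonneg hβ]
  calc _ ≤ Γ * (3 / δ ^ 4 * |x - y|) + Γ * (3 / δ ^ 4 * |x - y|) := by gcongr
    _ = _ := by ring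

theorem abs_truncatedForce_le {δ L α β Γ x : ℝ} (hδ : 0 < δ) (hα : 0 ≤ α) (hβ : 0 ≤ β)
    (hαΓ : α ≤ Γ) (hβΓ : β ≤ Γ) : |truncatedForce δ L α β x| ≤ 2 * Γ * δ⁻¹ ^ 3 := by
  have h : ∀ y, 0 ≤ (max δ y)⁻¹ ∧ (max δ y)⁻¹ ≤ δ⁻¹ := fun y =>
    ⟨inv_nonneg.2 (hδ.le.trans (le_max_left _ _)), inv_anti₀ hδ (le_max_left _ _)⟩
  unfold truncatedForce
  refine (abs_sub _ _).trans ?_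
  have hΓ : 0 ≤ Γ := hα.trans hαΓ
  have h1 := h x
  have h2 := h (L - x)
  rw [abs_of_nonneg (mul_nonneg hα (pow_nonneg h1.1 _)),
    abs_of_nonneg (mul_nonneg hβ (pow_nonneg h2.1 _))]
  calc _ ≤ Γ * δ⁻¹ ^ 3 + Γ * δ⁻¹ ^ 3 := by
        gcongr
        exacts [le_max_left _ _, le_max_left _ _]
    _ = _ := by ring

/-- Used with `g = id` for Grönwall's inequality, and with a clamp `g` for Picard–Lindelöf, where
the field must also be bounded. -/
theorem lipschitzWith_scaled_field {F g : ℝ → ℝ} {ε K : ℝ} (hε : 0 ≤ ε) (hK : 1 ≤ K)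
    (hF : ∀ x y, |F x - F y| ≤ K * |x - y|) (hg : ∀ x y, |g x - g y| ≤ |x - y|) :
    LipschitzWith (Real.toNNReal (ε * K)) (fun p : ℝ × ℝ => (ε * g p.2, ε * F p.1)) := by
  refine LipschitzWith.of_dist_le_mul fun p q => ?_
  rw [Real.coe_toNNReal _ (by positivity), Prod.dist_eq]
  have h1 : |p.1 - q.1| ≤ dist p q := le_max_left _ _
  have h2 : |p.2 - q.2| ≤ dist p q := le_max_right _ _
  refine max_le ?_ ?_
  · simp only [Real.dist_eq, ← mul_sub, abs_mul, abs_of_nonneg hε]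
    calc ε * |g p.2 - g q.2| ≤ ε * (1 * dist p q) := by
          rw [one_mul]; gcongr; exact (hg _ _).trans h2
      _ ≤ ε * K * dist p q := by rw [mul_assoc]; gcongr
  · simp only [Real.dist_eq, ← mul_sub, abs_mul, abs_of_nonneg hε]
    rw [mul_assoc]
    gcongr
    exact (hF _ _).trans (by gcongr)

/-- An approximate solution of the truncated averaged system, of accuracy `ε ^ 2`, stays during time
`T / ε` in an `ε`-neighbourhood of an exact solution. -/
theorem abs_sub_le_of_approx_solution {ε δ L α β Γ s T C₁ C₂ : ℝ} {X Q X' Q' Y W : ℝ → ℝ}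
    (hε : 0 < ε) (hδ : 0 < δ) (hα : 0 ≤ α) (hβ : 0 ≤ β) (hαΓ : α ≤ Γ) (hβΓ : β ≤ Γ)
    (hC₁ : 0 ≤ C₁) (hC₂ : 0 ≤ C₂) (hsT : s ≤ T / ε)
    (hXc : ContinuousOn X (Icc 0 s)) (hQc : ContinuousOn Q (Icc 0 s))
    (hX : ∀ t ∈ Ico 0 s, HasDerivWithinAt X (X' t) (Ici t) t)
    (hQ : ∀ t ∈ Ico 0 s, HasDerivWithinAt Q (Q' t) (Ici t) t)
    (hXe : ∀ t ∈ Ico 0 s, |X' t - ε * Q t| ≤ C₂ * ε ^ 2)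
    (hQe : ∀ t ∈ Ico 0 s, |Q' t - ε * truncatedForce δ L α β (X t)| ≤ C₂ * ε ^ 2)
    (hY : ∀ t ∈ Icc 0 s, HasDerivWithinAt Y (ε * W t) (Icc 0 s) t)
    (hW : ∀ t ∈ Icc 0 s,
      HasDerivWithinAt W (ε * truncatedForce δ L α β (Y t)) (Icc 0 s) t)
    (h0 : X 0 = Y 0) (h0' : |Q 0 - W 0| ≤ C₁ * ε) :
    ∀ t ∈ Icc 0 s, |X t - Y t| ≤ (C₁ + C₂) * Real.exp ((1 + 6 * Γ / δ ^ 4) * T) * ε ∧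
      |Q t - W t| ≤ (C₁ + C₂) * Real.exp ((1 + 6 * Γ / δ ^ 4) * T) * ε := by
  intro t ht
  have hΓ : 0 ≤ Γ := hα.trans hαΓ
  set K := 1 + 6 * Γ / δ ^ 4 with hKdef
  have hK0 : 0 ≤ 6 * Γ / δ ^ 4 := by positivity
  have hK : 1 ≤ K := by linarith
  have hlip := lipschitzWith_scaled_field (F := truncatedForce δ L α β) (g := id) hε.le hK
    (fun x y => (abs_truncatedForce_sub_le hδ hα hβ hαΓ hβΓ).trans
      (by gcongr; linarith)) (fun x y => le_rfl)
  have hmem : ∀ t ∈ Ico 0 s, Icc 0 s ∈ 𝓝[Ici t] t := fun t ht =>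
    mem_of_superset (Icc_mem_nhdsGE ht.2) (Icc_subset_Icc_left ht.1)
  have key := dist_le_of_approx_trajectories_ODE (v := fun _ p => (ε * id p.2,
      ε * truncatedForce δ L α β p.1)) (f := fun t => (X t, Q t)) (f' := fun t => (X' t, Q' t))
    (g := fun t => (Y t, W t)) (g' := fun t => (ε * W t, ε * truncatedForce δ L α β (Y t)))
    (a := 0) (b := s) (εf := C₂ * ε ^ 2) (εg := 0) (δ := C₁ * ε) (fun _ => hlip)
    (hXc.prodMk hQc) (fun t ht => (hX t ht).prodMk (hQ t ht))
    (fun t ht => max_le (hXe t ht) (hQe t ht))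
    (ContinuousOn.prodMk (fun t ht => (hY t ht).continuousWithinAt)
      fun t ht => (hW t ht).continuousWithinAt)
    (fun t ht => ((hY t ⟨ht.1, ht.2.le⟩).mono_of_mem_nhdsWithin (hmem t ht)).prodMk
      ((hW t ⟨ht.1, ht.2.le⟩).mono_of_mem_nhdsWithin (hmem t ht)))
    (fun t ht => by simp)
    (by
      refine max_le ?_ h0'
      simp only [h0, dist_self]
      positivity) t ht
  have hεK : 0 < ε * K := by positivity
  rw [Real.coe_toNNReal _ hεK.le, gronwallBound_of_K_ne_0 hεK.ne', add_zero, sub_zero] at key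
  -- The Lipschitz constant is of order `ε` and the time of order `1 / ε`, so the exponential stays
  -- bounded and the defect `C₂ * ε ^ 2` accumulates only to order `ε`.
  have htT : ε * K * t ≤ K * T := by
    have : t ≤ T / ε := ht.2.trans hsT
    rw [le_div_iff₀ hε] at this
    nlinarith
  have hexp := Real.exp_le_exp.2 htT
  have hb : C₁ * ε * Real.exp (ε * K * t) +
      C₂ * ε ^ 2 / (ε * K) * (Real.exp (ε * K * t) - 1) ≤ (C₁ + C₂) * Real.exp (K * T) * ε := by
    have e : C₂ * ε ^ 2 / (ε * K) ≤ C₂ * ε := by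
      rw [div_le_iff₀ hεK]
      nlinarith [mul_nonneg hC₂ (sq_nonneg ε)]
    have h1 : 0 ≤ Real.exp (ε * K * t) - 1 := by
      rw [sub_nonneg]; exact Real.one_le_exp (mul_nonneg hεK.le ht.1)
    calc _ ≤ C₁ * ε * Real.exp (K * T) + C₂ * ε * Real.exp (K * T) := by
          gcongr; linarith
      _ = _ := by ring
  exact ⟨((le_max_left _ _).trans key).trans hb, ((le_max_right _ _).trans key).trans hb⟩

/-- Conservation of energy in the averaged system. -/
theorem averaged_energy_eq {ε L α β s : ℝ} {X W : ℝ → ℝ}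
    (hmem : ∀ t ∈ Icc 0 s, X t ∈ Ioo 0 L)
    (hX : ∀ t ∈ Icc 0 s, HasDerivWithinAt X (ε * W t) (Icc 0 s) t)
    (hW : ∀ t ∈ Icc 0 s,
      HasDerivWithinAt W (ε * (α / X t ^ 3 - β / (L - X t) ^ 3)) (Icc 0 s) t) :
    ∀ t ∈ Icc 0 s, W t ^ 2 + α / X t ^ 2 + β / (L - X t) ^ 2 =
      W 0 ^ 2 + α / X 0 ^ 2 + β / (L - X 0) ^ 2 := by
  have hd : ∀ t ∈ Icc 0 s, HasDerivWithinAt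
      (fun t => W t ^ 2 + α / X t ^ 2 + β / (L - X t) ^ 2) 0 (Icc 0 s) t := by
    intro t ht
    have hx : X t ≠ 0 := (hmem t ht).1.ne'
    have hx' : L - X t ≠ 0 := (sub_pos.2 (hmem t ht).2).ne'
    have h1 := (hW t ht).fun_pow 2
    have h2 := ((hasDerivWithinAt_const t (Icc 0 s) α).fun_div ((hX t ht).fun_pow 2)
      (pow_ne_zero 2 hx))
    have h3 := ((hasDerivWithinAt_const t (Icc 0 s) β).fun_div
      (((hX t ht).const_sub L).fun_pow 2) (pow_ne_zero 2 hx'))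
    refine ((h1.fun_add h2).fun_add h3).congr_deriv ?_
    norm_num
    field_simp
    ring
  intro t ht
  refine constant_of_has_deriv_right_zero (fun t ht => (hd t ht).continuousWithinAt)
    (fun t ht => (hd t ⟨ht.1, ht.2.le⟩).mono_of_mem_nhdsWithin
      (mem_of_superset (Icc_mem_nhdsGE ht.2) (Icc_subset_Icc_left ht.1))) t ht

/-- Energy keeps the piston of the averaged system away from the walls. -/
theorem averaged_bounds {L α β R δ x w : ℝ} (hδ : 0 < δ) (hR : 0 < R) (hα : δ ^ 2 * R ^ 2 < α)
    (hβ : δ ^ 2 * R ^ 2 < β) (hx : x ∈ Ioo 0 L)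
    (hE : w ^ 2 + α / x ^ 2 + β / (L - x) ^ 2 ≤ R ^ 2) :
    δ < x ∧ x < L - δ ∧ |w| ≤ R := by
  have hx0 : 0 < x := hx.1
  have hx1 : 0 < L - x := sub_pos.2 hx.2
  have hα0 : 0 < α := lt_of_le_of_lt (by positivity) hα
  have hβ0 : 0 < β := lt_of_le_of_lt (by positivity) hβ
  have a1 : 0 ≤ α / x ^ 2 := by positivity
  have a2 : 0 ≤ β / (L - x) ^ 2 := by positivity
  have a3 : 0 ≤ w ^ 2 := by positivity
  have key : ∀ {y γ : ℝ}, 0 < y → δ ^ 2 * R ^ 2 < γ → γ / y ^ 2 ≤ R ^ 2 → δ < y := by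
    intro y γ hy hγ h
    rw [div_le_iff₀ (by positivity)] at h
    have h2 : R ^ 2 * δ ^ 2 < R ^ 2 * y ^ 2 := by linarith
    exact lt_of_pow_lt_pow_left₀ 2 hy.le (lt_of_mul_lt_mul_left h2 (by positivity))
  refine ⟨key hx0 hα (by linarith), ?_, abs_le_of_sq_le_sq (by linarith) hR.le⟩
  have := key hx1 hβ (by linarith)
  linarith

/-- Solutions of the averaged system exist for all times. -/
theorem exists_averaged_solution {ε L α β R δ τ X₀ W₀ : ℝ} (hε : 0 < ε) (hδ : 0 < δ) (hR : 0 < R)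
    (hτ : 0 ≤ τ) (hα : δ ^ 2 * R ^ 2 < α) (hβ : δ ^ 2 * R ^ 2 < β) (hX₀ : X₀ ∈ Ioo 0 L)
    (hE : W₀ ^ 2 + α / X₀ ^ 2 + β / (L - X₀) ^ 2 ≤ R ^ 2) :
    ∃ X W : ℝ → ℝ, X 0 = X₀ ∧ W 0 = W₀ ∧ (∀ t ∈ Icc 0 τ, X t ∈ Ioo 0 L) ∧
      (∀ t ∈ Icc 0 τ, HasDerivWithinAt X (ε * W t) (Icc 0 τ) t) ∧
      ∀ t ∈ Icc 0 τ,
        HasDerivWithinAt W (ε * (α / X t ^ 3 - β / (L - X t) ^ 3)) (Icc 0 τ) t := by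
  have hα0 : 0 < α := lt_of_le_of_lt (by positivity) hα
  have hβ0 : 0 < β := lt_of_le_of_lt (by positivity) hβ
  set Γ := max α β with hΓdef
  have hΓ : 0 < Γ := hα0.trans_le (le_max_left _ _)
  set K := 1 + 6 * Γ / δ ^ 4 with hKdef
  have hK0 : 0 ≤ 6 * Γ / δ ^ 4 := by positivity
  have hK : 1 ≤ K := by linarith
  -- Clamping at twice the energy bound `R` bounds the field globally by `ε * B`, so a ball of
  -- radius `ε * B * τ` serves for the whole of `[0, τ]`.
  set g : ℝ → ℝ := fun w => max (-(2 * R)) (min (2 * R) w) with hg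
  have hg_lip : ∀ x y, |g x - g y| ≤ |x - y| := by
    intro x y
    have h1 := abs_max_sub_max_le_max (-(2 * R)) (min (2 * R) x) (-(2 * R)) (min (2 * R) y)
    have h2 := abs_min_sub_min_le_max (2 * R) x (2 * R) y
    simp only [sub_self, abs_zero, abs_nonneg, sup_of_le_right] at h1 h2
    exact h1.trans h2
  have hg_le : ∀ x, |g x| ≤ 2 * R := fun x =>
    abs_le.2 ⟨le_max_left _ _, max_le (by linarith) (min_le_left _ _)⟩
  have hg_eq : ∀ x, |x| ≤ 2 * R → g x = x := by
    intro x hx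
    rw [abs_le] at hx
    simp only [hg]
    rw [min_eq_right hx.2, max_eq_right hx.1]
  have hlip := lipschitzWith_scaled_field (F := truncatedForce δ L α β) (g := g) hε.le hK
    (fun x y => (abs_truncatedForce_sub_le hδ hα0.le hβ0.le (le_max_left _ _)
      (le_max_right _ _)).trans (by gcongr; linarith)) hg_lip
  set B : ℝ := 2 * R + 2 * Γ * δ⁻¹ ^ 3 with hB
  have hB0 : 0 ≤ B := by positivity
  have hPL : IsPicardLindelof (fun _ (p : ℝ × ℝ) => (ε * g p.2, ε * truncatedForce δ L α β p.1))
      (tmin := 0) (tmax := τ) ⟨0, le_rfl, hτ⟩ (X₀, W₀) (Real.toNNReal (ε * B * τ)) 0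
      (Real.toNNReal (ε * B)) (Real.toNNReal (ε * K)) := by
    refine IsPicardLindelof.of_time_independent (fun p _ => ?_) hlip.lipschitzOnWith ?_
    · rw [Real.coe_toNNReal _ (by positivity), Prod.norm_def]
      have h1 := hg_le p.2
      have h2 := abs_truncatedForce_le (L := L) (x := p.1) hδ hα0.le hβ0.le (le_max_left α β)
        (le_max_right α β)
      have h3 : 0 ≤ 2 * Γ * δ⁻¹ ^ 3 := by positivity
      refine max_le ?_ ?_
      · simp only [Real.norm_eq_abs, abs_mul, abs_of_pos hε]
        gcongr; linarith
      · simp only [Real.norm_eq_abs, abs_mul, abs_of_pos hε]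
        gcongr; linarith
    · rw [Real.coe_toNNReal _ (by positivity), Real.coe_toNNReal _ (by positivity)]
      simp [hτ]
  obtain ⟨f, hf0, hf⟩ := hPL.exists_eq_forall_mem_Icc_hasDerivWithinAt₀
  simp only at hf0
  have hX : ∀ t ∈ Icc 0 τ, HasDerivWithinAt (fun t => (f t).1) (ε * g (f t).2) (Icc 0 τ) t :=
    fun t ht => (hf t ht).fst
  have hW : ∀ t ∈ Icc 0 τ, HasDerivWithinAt (fun t => (f t).2)
      (ε * truncatedForce δ L α β (f t).1) (Icc 0 τ) t := fun t ht => (hf t ht).snd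
  have h00 : (f 0).1 = X₀ ∧ (f 0).2 = W₀ := by rw [hf0]; exact ⟨rfl, rfl⟩
  have hb0 := averaged_bounds hδ hR hα hβ hX₀ hE
  -- Bootstrap: while the non-strict bounds hold, the truncations are inactive, energy is conserved,
  -- and `averaged_bounds` returns the strict bounds.
  have key : ∀ t ∈ Icc 0 τ, δ < (f t).1 ∧ (f t).1 < L - δ ∧ |(f t).2| < 2 * R := by
    apply forall_mem_Icc_of_forall_Ico
    · rw [h00.1, h00.2]
      exact ⟨hb0.1, hb0.2.1, by linarith [hb0.2.2]⟩
    · intro t ht h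
      have hp := h t ⟨ht.1, le_rfl⟩
      have hm : Icc 0 τ ∈ 𝓝[>] t :=
        mem_of_superset (Icc_mem_nhdsGT ht.2) (Icc_subset_Icc_left ht.1)
      have c1 := (hX t ⟨ht.1, ht.2.le⟩).continuousWithinAt.mono_of_mem_nhdsWithin hm
      have c2 := (hW t ⟨ht.1, ht.2.le⟩).continuousWithinAt.mono_of_mem_nhdsWithin hm
      filter_upwards [c1.eventually (lt_mem_nhds hp.1), c1.eventually (gt_mem_nhds hp.2.1),
        c2.abs.eventually (gt_mem_nhds hp.2.2)] with u h1 h2 h3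
      exact ⟨h1, h2, h3⟩
    · intro t ht h
      have hsub : Icc 0 t ⊆ Icc 0 τ := Icc_subset_Icc_right ht.2
      have hm : Icc 0 τ ∈ 𝓝[<] t :=
        mem_of_superset (Icc_mem_nhdsLT ht.1) (Icc_subset_Icc_right ht.2)
      have hev : ∀ᶠ u in 𝓝[<] t, u ∈ Ico 0 t := Ico_mem_nhdsLT ht.1
      have c1 := (hX t ⟨ht.1.le, ht.2⟩).continuousWithinAt.mono_of_mem_nhdsWithin hm
      have c2 := (hW t ⟨ht.1.le, ht.2⟩).continuousWithinAt.mono_of_mem_nhdsWithin hm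
      have hw : ∀ r ∈ Icc 0 t, δ ≤ (f r).1 ∧ (f r).1 ≤ L - δ ∧ |(f r).2| ≤ 2 * R := by
        intro r hr
        rcases hr.2.eq_or_lt with h' | h'
        · rw [h']
          exact ⟨ge_of_tendsto c1 (hev.mono fun u hu => (h u hu).1.le),
            le_of_tendsto c1 (hev.mono fun u hu => (h u hu).2.1.le),
            le_of_tendsto c2.abs (hev.mono fun u hu => (h u hu).2.2.le)⟩
        · have := h r ⟨hr.1, h'⟩
          exact ⟨this.1.le, this.2.1.le, this.2.2.le⟩
      have hmem : ∀ r ∈ Icc 0 t, (f r).1 ∈ Ioo 0 L := fun r hr =>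
        ⟨by linarith [(hw r hr).1], by linarith [(hw r hr).2.1]⟩
      have hen := averaged_energy_eq (ε := ε) (α := α) (β := β) (W := fun r => (f r).2) hmem
        (fun r hr => ((hX r (hsub hr)).mono hsub).congr_deriv (by rw [hg_eq _ (hw r hr).2.2]))
        (fun r hr => ((hW r (hsub hr)).mono hsub).congr_deriv
          (by rw [truncatedForce_eq (hw r hr).1 (hw r hr).2.1])) t ⟨ht.1.le, le_rfl⟩
      simp only [h00.1, h00.2] at hen
      have := averaged_bounds hδ hR hα hβ (hmem t ⟨ht.1.le, le_rfl⟩) (hen.trans_le hE)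
      exact ⟨this.1, this.2.1, by linarith [this.2.2]⟩
  refine ⟨fun t => (f t).1, fun t => (f t).2, h00.1, h00.2, fun t ht => ?_, fun t ht => ?_,
    fun t ht => ?_⟩
  · exact ⟨by linarith [(key t ht).1], by linarith [(key t ht).2.1]⟩
  · exact (hX t ht).congr_deriv (by rw [hg_eq _ (key t ht).2.2.le])
  · exact (hW t ht).congr_deriv (by rw [truncatedForce_eq (key t ht).1.le (key t ht).2.1.le])

theorem deriv_averagedHamiltonian_momentum {ε L A B P X : ℝ} :
    deriv (fun p => averagedHamiltonian ε L A B p X) P = ε ^ 2 * P := by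
  unfold averagedHamiltonian
  have h := ((((hasDerivAt_id P).fun_pow 2).const_mul (ε ^ 2)).div_const 2).add_const
    (Real.pi ^ 2 * A / (2 * X ^ 2)) |>.add_const (Real.pi ^ 2 * B / (2 * (L - X) ^ 2))
  refine (h.congr_deriv ?_).deriv
  simp
  ring

theorem deriv_averagedHamiltonian_position {ε L A B P X : ℝ} (hX : X ∈ Ioo 0 L) :
    -deriv (fun x => averagedHamiltonian ε L A B P x) X =
      Real.pi ^ 2 * A / X ^ 3 - Real.pi ^ 2 * B / (L - X) ^ 3 := by
  have hx : X ≠ 0 := hX.1.ne'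
  have hx' : L - X ≠ 0 := (sub_pos.2 hX.2).ne'
  unfold averagedHamiltonian
  have h2 := (hasDerivAt_const X (Real.pi ^ 2 * A)).fun_div
    (((hasDerivAt_id X).fun_pow 2).const_mul 2) (by simpa using hx)
  have h3 := (hasDerivAt_const X (Real.pi ^ 2 * B)).fun_div
    ((((hasDerivAt_id X).const_sub L).fun_pow 2).const_mul 2) (by simpa using hx')
  have h := ((hasDerivAt_const X (ε ^ 2 * P ^ 2 / 2)).fun_add h2).fun_add h3
  have e := h.deriv
  simp only [id] at e
  rw [e]
  norm_num
  field_simp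
  ring

/-- In the scaled momentum `ε * P` both equations carry one factor `ε`, the slow form to which the
stability estimate applies. -/
theorem isAveragedMotion_iff {ε L A B s : ℝ} {P X : ℝ → ℝ} (hε : 0 < ε) :
    IsAveragedMotion ε L A B s P X ↔ (∀ t ∈ Icc 0 s, X t ∈ Ioo 0 L) ∧
      (∀ t ∈ Icc 0 s, HasDerivWithinAt X (ε * (ε * P t)) (Icc 0 s) t) ∧
      ∀ t ∈ Icc 0 s, HasDerivWithinAt (fun t => ε * P t)
        (ε * (Real.pi ^ 2 * A / X t ^ 3 - Real.pi ^ 2 * B / (L - X t) ^ 3)) (Icc 0 s) t := by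
  constructor
  · rintro ⟨h1, h2, h3⟩
    refine ⟨h1, fun t ht => ?_, fun t ht => ?_⟩
    · exact (h2 t ht).congr_deriv (by rw [deriv_averagedHamiltonian_momentum]; ring)
    · rw [← deriv_averagedHamiltonian_position (h1 t ht)]
      exact (h3 t ht).const_mul ε
  · rintro ⟨h1, h2, h3⟩
    refine ⟨h1, fun t ht => ?_, fun t ht => ?_⟩
    · exact (h2 t ht).congr_deriv (by rw [deriv_averagedHamiltonian_momentum]; ring)
    · rw [deriv_averagedHamiltonian_position (h1 t ht)]
      have := (h3 t ht).const_mul ε⁻¹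
      simpa only [inv_mul_cancel_left₀ hε.ne'] using this

end

/-! ### Conservation of energy and almost conserved functionals along a motion. -/

noncomputable section

namespace PistonState

variable {m n : ℕ}

section Motion

variable {M L s R δ : ℝ} {z : ℝ → PistonState m n}

theorem IsMotion.energy_eq (h : IsMotion M L s z) (hM : 0 < M) :
    ∀ t ∈ Icc 0 s, (z t).energy M = (z 0).energy M := by
  have hr : ∀ t ∈ Ico 0 s, ∀ᶠ u in 𝓝[>] t, (z u).energy M = (z t).energy M := by
    intro t ht
    filter_upwards [h.after t ht] with u hu
    rw [hu, energy_free, (h.admissible t ⟨ht.1, ht.2.le⟩).energy_impact hM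
      (h.no_simultaneous t ht)]
  have hl : ∀ t ∈ Ioc 0 s, ∀ᶠ u in 𝓝[<] t, (z t).energy M = (z u).energy M := by
    intro t ht
    filter_upwards [h.before t ht] with u hu
    rw [hu, energy_free]
  intro t ht
  refine le_antisymm ?_ ?_
  · simpa using le_add_mul_of_eventually (c := 0) (g := fun t => (z t).energy M)
      (fun t ht => (hr t ht).mono fun u hu => by simp [hu])
      (fun t ht => (hl t ht).mono fun u hu => by simp [hu]) t ht
  · simpa using le_add_mul_of_eventually (c := 0) (g := fun t => -(z t).energy M)
      (fun t ht => (hr t ht).mono fun u hu => by simp [hu])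
      (fun t ht => (hl t ht).mono fun u hu => by simp [hu]) t ht

theorem IsMotion.energy_le (h : IsMotion M L s z) (hM : 0 < M) (hE : (z 0).energy M ≤ R ^ 2) :
    ∀ t ∈ Icc 0 s, ∀ w, w = z t ∨ t < s ∧ w = (z t).impact M L → w.energy M ≤ R ^ 2 := by
  rintro t ht w (rfl | ⟨hts, rfl⟩)
  · rwa [h.energy_eq hM t ht]
  · rwa [(h.admissible t ht).energy_impact hM (h.no_simultaneous t ⟨ht.1, hts⟩),
      h.energy_eq hM t ht]

theorem IsMotion.continuousOn_X (h : IsMotion M L s z) :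
    ContinuousOn (fun t => (z t).X) (Icc 0 s) :=
  h.continuousOn (f := PistonState.X) (fun _ _ => rfl) fun _ _ => hasDerivAt_X.continuousAt

/-- A functional constant in free flight and changed by impacts by no more than a multiple of the
change of the velocity of the piston is almost constant along a motion away from the walls. -/
theorem IsMotion.abs_sub_le_of_impact (h : IsMotion M L s z) (hM : 1 ≤ M) (hR : 0 ≤ R)
    (hδ : 0 < δ) (hE : (z 0).energy M ≤ R ^ 2)
    (hX : ∀ t ∈ Icc 0 s, δ ≤ (z t).X ∧ (z t).X ≤ L - δ) {f : PistonState m n → ℝ} {κ : ℝ}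
    (hκ : 0 ≤ κ) (hfree : ∀ w u, f (free M u w) = f w)
    (himp : ∀ w : PistonState m n, w.Admissible L → w.AtMostOneContact → w.energy M ≤ R ^ 2 →
      |f (w.impact M L) - f w| ≤ κ * (|(w.impact M L).P - w.P| / M)) :
    ∀ t ∈ Icc 0 s, |f (z t) - f (z 0)| ≤
      (κ * (2 * ((m + n) * R)) + (κ * ((m + n) * (2 * R ^ 2 / δ)) + 1) * t) / M := by
  have hM0 : 0 < M := by linarith
  have hEt := h.energy_le hM0 hE
  have key : ∀ σ : ℝ, |σ| = 1 → ∀ t ∈ Icc 0 s, σ * (f (z t) - f (z 0)) ≤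
      (κ * (2 * ((m + n) * R)) + (κ * ((m + n) * (2 * R ^ 2 / δ)) + 1) * t) / M := by
    intro σ hσ t ht
    -- The drop of the virial difference pays for the jump of `f`, so the combination never
    -- increases at an impact. The signs `σ = ±1` give both inequalities; the `+ 1` in `c` provides
    -- the strict inequality required of the rate.
    have h1 := h.le_add_mul (f := fun w => σ * f w + κ / M * (w.virialLeft - w.virialRight L))
      (c := (κ * ((m + n) * (2 * R ^ 2 / δ)) + 1) / M) ?_ ?_ t ht
    · have hb : ∀ t ∈ Icc 0 s,
          |(z t).virialLeft - (z t).virialRight L| ≤ (m + n) * R := by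
        intro t ht
        have hp := abs_le_of_energy_le hM0 hR (hEt t ht _ (Or.inl rfl))
        have a1 := (h.admissible t ht).abs_virialLeft_le hp.1
        have a2 := (h.admissible t ht).abs_virialRight_le hp.2.1
        refine (abs_sub _ _).trans ?_
        linarith
      have b0 := (abs_le.1 (hb 0 ⟨le_rfl, ht.1.trans ht.2⟩)).2
      have bt := (abs_le.1 (hb t ht)).1
      have hκM : 0 ≤ κ / M := by positivity
      have b1 := mul_le_mul_of_nonneg_left (a := κ / M) (sub_le_sub b0 bt) hκM
      have e : (κ * (2 * ((m + n) * R)) + (κ * ((m + n) * (2 * R ^ 2 / δ)) + 1) * t) / M =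
        κ / M * ((m + n) * R - -((m + n) * R)) +
          (κ * ((m + n) * (2 * R ^ 2 / δ)) + 1) / M * t := by ring
      rw [e]
      linarith
    · intro t ht
      have had := h.admissible t ⟨ht.1, ht.2.le⟩
      have i1 := himp (z t) had (h.no_simultaneous t ht) (hEt t ⟨ht.1, ht.2.le⟩ _ (Or.inl rfl))
      have i2 := had.abs_impact_P_sub_le (M := M) hM0
      have hκM : 0 ≤ κ / M := by positivity
      have i3 := mul_le_mul_of_nonneg_left i2 hκM
      have i4 : σ * (f ((z t).impact M L) - f (z t)) ≤
          |f ((z t).impact M L) - f (z t)| := by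
        refine (le_abs_self _).trans ?_
        rw [abs_mul, hσ, one_mul]
      have e : κ * (|((z t).impact M L).P - (z t).P| / M) =
        κ / M * |((z t).impact M L).P - (z t).P| := by ring
      rw [e] at i1
      linarith
    · intro t ht w hw
      have hwE : w.energy M ≤ R ^ 2 := hEt t ht w hw
      have had : w.Admissible L := by
        rcases hw with rfl | ⟨-, rfl⟩
        · exact h.admissible t ht
        · exact (h.admissible t ht).impact
      have hwX : w.X = (z t).X := by
        rcases hw with rfl | ⟨-, rfl⟩ <;> rfl
      have hp := abs_le_of_energy_le hM0 hR hwE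
      have hV := abs_velocity_le_of_energy_le hM hR hwE
      have f1 := had.abs_forceLeft_le hδ (hwX ▸ (hX t ht).1) hp.1 hV
      have f2 := had.abs_forceRight_le hδ (by rw [hwX]; linarith [(hX t ht).2]) hp.2.1 hV
      refine ⟨κ / M * (w.forceLeft M - -w.forceRight M L), ?_, ?_⟩
      · have hκM : 0 ≤ κ / M := by positivity
        have : w.forceLeft M - -w.forceRight M L ≤ (m + n) * (2 * R ^ 2 / δ) := by
          linarith [(abs_le.1 f1).2, (abs_le.1 f2).2]
        have := mul_le_mul_of_nonneg_left this hκM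
        have e : (κ * ((m + n) * (2 * R ^ 2 / δ)) + 1) / M =
          κ / M * ((m + n) * (2 * R ^ 2 / δ)) + 1 / M := by ring
        have : 0 < 1 / M := by positivity
        linarith
      · simp only [hfree]
        exact ((had.hasDerivAt_virialLeft.fun_sub had.hasDerivAt_virialRight).const_mul
          _).const_add _
  intro t ht
  refine abs_le.2 ⟨?_, ?_⟩
  · linarith [key (-1) (by simp) t ht]
  · linarith [key 1 (by simp) t ht]

end Motion

end PistonState
end

/-! ### Adiabatic invariants against actions and forces; confinement of the piston. -/

noncomputable section

namespace PistonState

variable {m n : ℕ}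

section Bounds

variable {M L R δ V : ℝ} {z : PistonState m n}

/-- Since `xl ≤ X`, the invariant is at most of order `X ^ 2`; a lower bound on it therefore keeps
the piston off the wall. -/
theorem Admissible.adiabaticLeft_le (h : z.Admissible L) (hp : ∀ i, |z.pl i| ≤ R)
    (hV : |z.P / M| ≤ R) : z.adiabaticLeft M ≤ m * (z.X * (2 * R)) ^ 2 := by
  refine (Finset.sum_le_card_nsmul _ _ ((z.X * (2 * R)) ^ 2) fun i _ => ?_).trans (by simp)
  rw [← sq_abs]
  have hR : 0 ≤ R := (abs_nonneg _).trans hV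
  refine pow_le_pow_left₀ (abs_nonneg _) ((abs_sub _ _).trans ?_) 2
  have hx := h.2.2.1 i
  rw [abs_mul, abs_mul, abs_of_pos h.1, abs_of_nonneg hx.1]
  calc |z.pl i| * z.X + z.xl i * |z.P / M| ≤ R * z.X + z.X * R := by
        have := h.1.le
        gcongr
        exacts [hp i, hx.2]
    _ = _ := by ring

theorem Admissible.adiabaticRight_le (h : z.Admissible L) (hp : ∀ j, |z.pr j| ≤ R)
    (hV : |z.P / M| ≤ R) : z.adiabaticRight M L ≤ n * ((L - z.X) * (2 * R)) ^ 2 := by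
  refine (Finset.sum_le_card_nsmul _ _ (((L - z.X) * (2 * R)) ^ 2) fun i _ => ?_).trans (by simp)
  rw [← sq_abs]
  have hR : 0 ≤ R := (abs_nonneg _).trans hV
  refine pow_le_pow_left₀ (abs_nonneg _) ((abs_sub _ _).trans ?_) 2
  have hx := h.2.2.2 i
  have hx1 : 0 ≤ L - z.xr i := sub_nonneg.2 hx.2
  have hX1 : 0 < L - z.X := sub_pos.2 h.2.1
  rw [abs_mul, abs_mul, abs_of_pos hX1, abs_of_nonneg hx1]
  calc |z.pr i| * (L - z.X) + (L - z.xr i) * |z.P / M| ≤ R * (L - z.X) + (L - z.X) * R := by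
        gcongr
        exacts [hp i, hx.1]
    _ = _ := by ring

/-- The adiabatic invariants differ from the actions by `O(V)`. -/
theorem Admissible.abs_adiabaticLeft_sub_le (h : z.Admissible L) (hp : ∀ i, |z.pl i| ≤ R)
    (hV : |z.P / M| ≤ V) (hVR : V ≤ R) :
    |z.adiabaticLeft M - Real.pi ^ 2 * ∑ i, z.actionLeft i ^ 2| ≤
      m * (4 * R * L ^ 2 * V) := by
  have hR : 0 ≤ R := ((abs_nonneg _).trans hV).trans hVR
  unfold adiabaticLeft
  rw [Finset.mul_sum, ← Finset.sum_sub_distrib]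
  refine (Finset.abs_sum_le_sum_abs _ _).trans ?_
  refine (Finset.sum_le_card_nsmul _ _ (4 * R * L ^ 2 * V) fun i _ => ?_).trans (by simp)
  have hX : |z.X| ≤ L := by rw [abs_of_pos h.1]; exact h.2.1.le
  have hx : |z.xl i| ≤ L := by
    rw [abs_of_nonneg (h.2.2.1 i).1]; exact (h.2.2.1 i).2.trans h.2.1.le
  -- With the velocity replaced by `0`, the invariant is `π ^ 2` times the squared action.
  have := abs_sq_sub_sq_le (U := 0) hX hx (hp i) (by simpa using hR) (hV.trans hVR)
  have e : Real.pi ^ 2 * z.actionLeft i ^ 2 = (z.pl i * z.X - z.xl i * 0) ^ 2 := by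
    unfold actionLeft
    have := Real.pi_ne_zero
    field_simp
    rw [sq_abs]; ring
  rw [e]
  refine this.trans ?_
  rw [sub_zero]
  gcongr

theorem Admissible.abs_adiabaticRight_sub_le (h : z.Admissible L) (hp : ∀ i, |z.pr i| ≤ R)
    (hV : |z.P / M| ≤ V) (hVR : V ≤ R) :
    |z.adiabaticRight M L - Real.pi ^ 2 * ∑ i, z.actionRight L i ^ 2| ≤
      n * (4 * R * L ^ 2 * V) := by
  have hR : 0 ≤ R := ((abs_nonneg _).trans hV).trans hVR
  unfold adiabaticRight
  rw [Finset.mul_sum, ← Finset.sum_sub_distrib]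
  refine (Finset.abs_sum_le_sum_abs _ _).trans ?_
  refine (Finset.sum_le_card_nsmul _ _ (4 * R * L ^ 2 * V) fun i _ => ?_).trans (by simp)
  have hX : |L - z.X| ≤ L := by rw [abs_of_pos (sub_pos.2 h.2.1)]; linarith [h.1]
  have hx : |L - z.xr i| ≤ L := by
    rw [abs_of_nonneg (sub_nonneg.2 (h.2.2.2 i).2)]; linarith [(h.2.2.2 i).1, h.1]
  have := abs_sq_sub_sq_le (U := 0) hX hx (hp i) (by simpa using hR) (hV.trans hVR)
  have e : Real.pi ^ 2 * z.actionRight L i ^ 2 =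
      (z.pr i * (L - z.X) - (L - z.xr i) * 0) ^ 2 := by
    unfold actionRight
    have := Real.pi_ne_zero
    field_simp
    rw [sq_abs]; ring
  rw [e]
  refine this.trans ?_
  rw [sub_zero]
  gcongr

/-- The difference is exactly `y U (q Y - y U) / Y ^ 3`, with a factor `U`: at leading order the
force does not depend on the phase `y`. -/
theorem abs_force_sub_adiabatic_le {y Y q U : ℝ} (hδ : 0 < δ) (hq : |q| ≤ R) (hU : |U| ≤ V)
    (hVR : V ≤ R) (hy : 0 ≤ y) (hyY : y ≤ Y) (hY : δ ≤ Y) (hYL : Y ≤ L) :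
    |q ^ 2 / Y - q * y * U / Y ^ 2 - (q * Y - y * U) ^ 2 / Y ^ 3| ≤
      2 * R * L ^ 2 * V / δ ^ 3 := by
  have hY0 : 0 < Y := hδ.trans_le hY
  have hR : 0 ≤ R := (abs_nonneg _).trans hq
  have hV : 0 ≤ V := (abs_nonneg _).trans hU
  have hL : 0 ≤ L := hY0.le.trans hYL
  have e : q ^ 2 / Y - q * y * U / Y ^ 2 - (q * Y - y * U) ^ 2 / Y ^ 3 =
      y * U * (q * Y - y * U) / Y ^ 3 := by
    field_simp; ring
  rw [e, abs_div, abs_of_pos (pow_pos hY0 3)]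
  gcongr
  rw [abs_mul, abs_mul, abs_of_nonneg hy]
  have h1 : |q * Y - y * U| ≤ R * L + L * R := by
    refine (abs_sub _ _).trans ?_
    rw [abs_mul, abs_mul, abs_of_pos hY0, abs_of_nonneg hy]
    gcongr
    exacts [hyY.trans hYL, hU.trans hVR]
  calc y * |U| * |q * Y - y * U| ≤ L * V * (R * L + L * R) := by
        gcongr; exact hyY.trans hYL
    _ = _ := by ring

theorem Admissible.abs_forceLeft_sub_le {α η : ℝ} (h : z.Admissible L) (hδ : 0 < δ)
    (hX : δ ≤ z.X) (hp : ∀ i, |z.pl i| ≤ R) (hV : |z.P / M| ≤ V) (hVR : V ≤ R)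
    (hα : |z.adiabaticLeft M - α| ≤ η) :
    |z.forceLeft M - α / z.X ^ 3| ≤ (m * (2 * R * L ^ 2 * V) + η) / δ ^ 3 := by
  have h1 : |z.forceLeft M - z.adiabaticLeft M / z.X ^ 3| ≤
      m * (2 * R * L ^ 2 * V / δ ^ 3) := by
    unfold forceLeft adiabaticLeft
    rw [Finset.sum_div, ← Finset.sum_sub_distrib]
    refine (Finset.abs_sum_le_sum_abs _ _).trans ?_
    refine (Finset.sum_le_card_nsmul _ _ (2 * R * L ^ 2 * V / δ ^ 3) fun i _ => ?_).trans
      (by simp)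
    exact abs_force_sub_adiabatic_le hδ (hp i) hV hVR (h.2.2.1 i).1 (h.2.2.1 i).2 hX h.2.1.le
  have h2 : |z.adiabaticLeft M / z.X ^ 3 - α / z.X ^ 3| ≤ η / δ ^ 3 := by
    rw [← sub_div, abs_div, abs_of_pos (pow_pos h.1 3)]
    have : 0 ≤ η := (abs_nonneg _).trans hα
    gcongr
  refine (abs_sub_le _ (z.adiabaticLeft M / z.X ^ 3) _).trans ((add_le_add h1 h2).trans ?_)
  exact le_of_eq (by ring)

theorem Admissible.abs_forceRight_sub_le {α η : ℝ} (h : z.Admissible L) (hδ : 0 < δ)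
    (hX : δ ≤ L - z.X) (hp : ∀ i, |z.pr i| ≤ R) (hV : |z.P / M| ≤ V) (hVR : V ≤ R)
    (hα : |z.adiabaticRight M L - α| ≤ η) :
    |z.forceRight M L - α / (L - z.X) ^ 3| ≤ (n * (2 * R * L ^ 2 * V) + η) / δ ^ 3 := by
  have h1 : |z.forceRight M L - z.adiabaticRight M L / (L - z.X) ^ 3| ≤
      n * (2 * R * L ^ 2 * V / δ ^ 3) := by
    unfold forceRight adiabaticRight
    rw [Finset.sum_div, ← Finset.sum_sub_distrib]
    refine (Finset.abs_sum_le_sum_abs _ _).trans ?_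
    refine (Finset.sum_le_card_nsmul _ _ (2 * R * L ^ 2 * V / δ ^ 3) fun i _ => ?_).trans
      (by simp)
    exact abs_force_sub_adiabatic_le hδ (hp i) hV hVR (sub_nonneg.2 (h.2.2.2 i).2)
      (by linarith [(h.2.2.2 i).1]) hX (by linarith [h.1])
  have h2 : |z.adiabaticRight M L / (L - z.X) ^ 3 - α / (L - z.X) ^ 3| ≤ η / δ ^ 3 := by
    rw [← sub_div, abs_div, abs_of_pos (pow_pos (sub_pos.2 h.2.1) 3)]
    have : 0 ≤ η := (abs_nonneg _).trans hα
    gcongr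
  refine (abs_sub_le _ (z.adiabaticRight M L / (L - z.X) ^ 3) _).trans
    ((add_le_add h1 h2).trans ?_)
  exact le_of_eq (by ring)

end Bounds

section Motion

variable {M L s R δ : ℝ} {z : ℝ → PistonState m n}

/-- The Lipschitz-type constant of the adiabatic invariants in `IsMotion.abs_sub_le_of_impact`. -/
def impactConst (m n : ℕ) (R L : ℝ) : ℝ := (m + n) * (4 * R * L ^ 2)

/-- Bound of `M` times the change of the adiabatic invariants in time `s`. -/
def driftBound (m n : ℕ) (R L δ s : ℝ) : ℝ :=
  impactConst m n R L * (2 * ((m + n) * R)) +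
    (impactConst m n R L * ((m + n) * (2 * R ^ 2 / δ)) + 1) * s

theorem impactConst_nonneg (hR : 0 ≤ R) : 0 ≤ impactConst m n R L := by
  unfold impactConst; positivity

theorem driftBound_mono (hR : 0 ≤ R) (hδ : 0 < δ) {t : ℝ} (h : t ≤ s) :
    driftBound m n R L δ t ≤ driftBound m n R L δ s := by
  have := impactConst_nonneg (m := m) (n := n) (L := L) hR
  unfold driftBound; gcongr

theorem IsMotion.abs_adiabatic_sub_le (h : IsMotion M L s z) (hM : 1 ≤ M) (hR : 0 ≤ R)
    (hδ : 0 < δ) (hE : (z 0).energy M ≤ R ^ 2)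
    (hX : ∀ t ∈ Icc 0 s, δ ≤ (z t).X ∧ (z t).X ≤ L - δ) :
    ∀ t ∈ Icc 0 s, ∀ w, w = z t ∨ t < s ∧ w = (z t).impact M L →
      |w.adiabaticLeft M - (z 0).adiabaticLeft M| ≤ driftBound m n R L δ s / M ∧
      |w.adiabaticRight M L - (z 0).adiabaticRight M L| ≤ driftBound m n R L δ s / M := by
  have hM0 : 0 < M := by linarith
  have hκ := impactConst_nonneg (m := m) (n := n) (L := L) hR
  have h1 := h.abs_sub_le_of_impact hM hR hδ hE hX (f := adiabaticLeft M) hκ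
    (fun w u => adiabaticLeft_free u) fun w a b c =>
      (a.abs_adiabaticLeft_impact_sub_le hM hR b c).trans (by
        unfold impactConst; rw [mul_assoc ((m : ℝ) + n)]; gcongr; simp)
  have h2 := h.abs_sub_le_of_impact hM hR hδ hE hX (f := adiabaticRight M L) hκ
    (fun w u => adiabaticRight_free u) fun w a b c =>
      (a.abs_adiabaticRight_impact_sub_le hM hR b c).trans (by
        unfold impactConst; rw [mul_assoc ((m : ℝ) + n)]; gcongr; simp)
  have key : ∀ t ∈ Icc 0 s,
      |(z t).adiabaticLeft M - (z 0).adiabaticLeft M| ≤ driftBound m n R L δ s / M ∧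
      |(z t).adiabaticRight M L - (z 0).adiabaticRight M L| ≤ driftBound m n R L δ s / M := by
    intro t ht
    have hmono : driftBound m n R L δ t / M ≤ driftBound m n R L δ s / M := by
      gcongr; exact driftBound_mono hR hδ ht.2
    exact ⟨(h1 t ht).trans hmono, (h2 t ht).trans hmono⟩
  rintro t ht w (rfl | ⟨hts, rfl⟩)
  · exact key t ht
  -- The state after the impact is joined by free flight to the motion at a slightly later instant,
  -- where the invariants have the same values.
  · have hev : ∀ᶠ u in 𝓝[>] t, u ∈ Ioo t s := Ioo_mem_nhdsGT hts
    obtain ⟨u, hu, hu'⟩ := ((h.after t ⟨ht.1, hts⟩).and hev).exists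
    have := key u ⟨ht.1.trans hu'.1.le, hu'.2.le⟩
    rwa [hu, adiabaticLeft_free, adiabaticRight_free] at this

/-- Almost conservation of the adiabatic invariants keeps the piston away from the walls. -/
theorem IsMotion.mem_Ioo (h : IsMotion M L s z) (hM : 1 ≤ M) (hR : 0 < R)
    (hδ : 0 < δ) (hE : (z 0).energy M ≤ R ^ 2) (hX₀ : (z 0).X ∈ Ioo δ (L - δ))
    (hl : m * (δ * (2 * R)) ^ 2 < (z 0).adiabaticLeft M - driftBound m n R L δ s / M)
    (hr : n * (δ * (2 * R)) ^ 2 < (z 0).adiabaticRight M L - driftBound m n R L δ s / M) :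
    ∀ t ∈ Icc 0 s, (z t).X ∈ Ioo δ (L - δ) := by
  have hM0 : 0 < M := by linarith
  have hc := h.continuousOn_X
  apply forall_mem_Icc_of_forall_Ico (p := fun t => (z t).X ∈ Ioo δ (L - δ)) hX₀
  · intro t ht hp
    have hm : Icc 0 s ∈ 𝓝[>] t :=
      mem_of_superset (Icc_mem_nhdsGT ht.2) (Icc_subset_Icc_left ht.1)
    exact ((hc t ⟨ht.1, ht.2.le⟩).mono_of_mem_nhdsWithin hm).eventually
      (Ioo_mem_nhds (hp t ⟨ht.1, le_rfl⟩).1 (hp t ⟨ht.1, le_rfl⟩).2)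
  · intro t ht hp
    have htI : t ∈ Icc 0 s := ⟨ht.1.le, ht.2⟩
    have hm : Icc 0 s ∈ 𝓝[<] t :=
      mem_of_superset (Icc_mem_nhdsLT ht.1) (Icc_subset_Icc_right ht.2)
    have hev : ∀ᶠ u in 𝓝[<] t, u ∈ Ico 0 t := Ico_mem_nhdsLT ht.1
    have c1 := (hc t htI).mono_of_mem_nhdsWithin hm
    have hw : ∀ r ∈ Icc 0 t, δ ≤ (z r).X ∧ (z r).X ≤ L - δ := by
      intro r hr
      rcases hr.2.eq_or_lt with h' | h'
      · rw [h']
        exact ⟨ge_of_tendsto c1 (hev.mono fun u hu => (hp u hu).1.le),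
          le_of_tendsto c1 (hev.mono fun u hu => (hp u hu).2.le)⟩
      · exact ⟨(hp r ⟨hr.1, h'⟩).1.le, (hp r ⟨hr.1, h'⟩).2.le⟩
    -- The drift bound needs only the closed bounds up to `t`; combined with `hl` and `hr` it
    -- returns the open ones.
    have hd := (h.mono ht.2).abs_adiabatic_sub_le hM hR.le hδ hE hw t ⟨ht.1.le, le_rfl⟩ _
      (Or.inl rfl)
    have hmono : driftBound m n R L δ t / M ≤ driftBound m n R L δ s / M := by
      gcongr; exact driftBound_mono hR.le hδ ht.2
    have hEt := h.energy_le hM0 hE t htI _ (Or.inl rfl)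
    have hb := abs_le_of_energy_le hM0 hR.le hEt
    have hV := abs_velocity_le_of_energy_le hM hR.le hEt
    have had := h.admissible t htI
    have e1 := had.adiabaticLeft_le hb.1 hV
    have e2 := had.adiabaticRight_le hb.2.1 hV
    have d1 := (abs_le.1 hd.1).1
    have d2 := (abs_le.1 hd.2).1
    have key : ∀ {k : ℕ} {y : ℝ}, 0 < y → k * (δ * (2 * R)) ^ 2 < k * (y * (2 * R)) ^ 2 → δ < y := by
      intro k y hy hlt
      have h1 := lt_of_mul_lt_mul_left hlt (Nat.cast_nonneg k)
      have h2 := lt_of_pow_lt_pow_left₀ 2 (by positivity) h1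
      exact lt_of_mul_lt_mul_right h2 (by positivity)
    have k1 := key (k := m) had.1 (by linarith)
    have k2 := key (k := n) (sub_pos.2 had.2.1) (by linarith)
    exact ⟨k1, by linarith⟩

end Motion

end PistonState
end

/-! ### The averaging estimate under confinement. -/

noncomputable section

namespace PistonState

variable {m n : ℕ}

theorem abs_velocity_le_mul {ε R : ℝ} {z : PistonState m n} (hε : 0 < ε) (hR : 0 ≤ R)
    (hE : z.energy (1 / ε ^ 2) ≤ R ^ 2) : |z.P / (1 / ε ^ 2)| ≤ ε * R := by
  have h := (abs_le_of_energy_le (by positivity) hR hE).2.2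
  refine abs_le_of_sq_le_sq ?_ (by positivity)
  have e : (z.P / (1 / ε ^ 2)) ^ 2 = ε ^ 2 * (z.P ^ 2 / (1 / ε ^ 2)) := by field_simp
  rw [e, mul_pow]
  gcongr

/-- The averaging theorem for a motion away from the walls whose adiabatic invariants are known to
be almost constant. -/
theorem IsMotion.abs_sub_averaged_le {ε L s T R δ α β Γ D : ℝ} {z : ℝ → PistonState m n}
    {P X : ℝ → ℝ} (hε : 0 < ε) (hε1 : ε ≤ 1) (h : IsMotion (1 / ε ^ 2) L s z) (hsT : s ≤ T / ε)
    (hR : 0 ≤ R) (hδ : 0 < δ) (hE : (z 0).energy (1 / ε ^ 2) ≤ R ^ 2)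
    (hX : ∀ t ∈ Icc 0 s, (z t).X ∈ Ioo δ (L - δ)) (hα : 0 ≤ α) (hβ : 0 ≤ β) (hαΓ : α ≤ Γ)
    (hβΓ : β ≤ Γ) (hD : 0 ≤ D)
    (hA : ∀ t ∈ Icc 0 s, ∀ w, w = z t ∨ t < s ∧ w = (z t).impact (1 / ε ^ 2) L →
      |w.adiabaticLeft (1 / ε ^ 2) - α| ≤ D * ε ∧ |w.adiabaticRight (1 / ε ^ 2) L - β| ≤ D * ε)
    (hYmem : ∀ t ∈ Icc 0 s, δ ≤ X t ∧ X t ≤ L - δ)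
    (hY : ∀ t ∈ Icc 0 s, HasDerivWithinAt X (ε * (ε * P t)) (Icc 0 s) t)
    (hW : ∀ t ∈ Icc 0 s, HasDerivWithinAt (fun t => ε * P t)
      (ε * (α / X t ^ 3 - β / (L - X t) ^ 3)) (Icc 0 s) t)
    (hX0 : X 0 = (z 0).X) (hP0 : P 0 = (z 0).P) :
    ∀ t ∈ Icc 0 s,
      |ε * (z t).P - ε * P t| ≤ (((m + n) * R + ((m + n) * R +
        ((m + n) * (2 * R * L ^ 2 * R) + 2 * D) / δ ^ 3)) *
          Real.exp ((1 + 6 * Γ / δ ^ 4) * T) + (m + n) * R) * ε ∧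
      |(z t).X - X t| ≤ (((m + n) * R + ((m + n) * R +
        ((m + n) * (2 * R * L ^ 2 * R) + 2 * D) / δ ^ 3)) *
          Real.exp ((1 + 6 * Γ / δ ^ 4) * T) + (m + n) * R) * ε := by
  intro t₁ ht₁
  have hM0 : 0 < 1 / ε ^ 2 := by positivity
  have hEt := h.energy_le hM0 hE
  set G : PistonState m n → ℝ := fun w => w.virialLeft + w.virialRight L with hG
  have hGle : ∀ t ∈ Icc 0 s, |G (z t)| ≤ (m + n) * R := by
    intro t ht
    have hp := abs_le_of_energy_le hM0 hR (hEt t ht _ (Or.inl rfl))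
    have a1 := (h.admissible t ht).abs_virialLeft_le hp.1
    have a2 := (h.admissible t ht).abs_virialRight_le hp.2.1
    refine (abs_add_le _ _).trans ?_
    linarith
  have hfree : ∀ w : PistonState m n, w.Admissible L →
      HasDerivAt (fun u => ε * ((w.free (1 / ε ^ 2) u).P + G (w.free (1 / ε ^ 2) u)))
        (ε * (0 + (w.forceLeft (1 / ε ^ 2) + -w.forceRight (1 / ε ^ 2) L))) 0 := fun w hw =>
    (hasDerivAt_P.fun_add
      (hw.hasDerivAt_virialLeft.fun_add hw.hasDerivAt_virialRight)).const_mul ε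
  have hinv : ∀ t ∈ Ico 0 s, ε * (((z t).impact (1 / ε ^ 2) L).P +
      G ((z t).impact (1 / ε ^ 2) L)) = ε * ((z t).P + G (z t)) := fun t ht => by
    simp only [hG]
    rw [(h.admissible t ⟨ht.1, ht.2.le⟩).corrected_momentum_impact]
  -- The state at a collision instant is the one before it, so right derivatives are computed from
  -- the state after the impact.
  have hmain := abs_sub_le_of_approx_solution (L := L) (X := fun t => (z t).X)
    (Q := fun t => ε * ((z t).P + G (z t)))
    (X' := fun t => ((z t).impact (1 / ε ^ 2) L).P / (1 / ε ^ 2))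
    (Q' := fun t => ε * (0 + (((z t).impact (1 / ε ^ 2) L).forceLeft (1 / ε ^ 2) +
      -((z t).impact (1 / ε ^ 2) L).forceRight (1 / ε ^ 2) L)))
    (Y := X) (W := fun t => ε * P t) (C₁ := (m + n) * R)
    (C₂ := (m + n) * R + ((m + n) * (2 * R * L ^ 2 * R) + 2 * D) / δ ^ 3)
    hε hδ hα hβ hαΓ hβΓ (by positivity) (by positivity) hsT h.continuousOn_X
    (h.continuousOn (f := fun w => ε * (w.P + G w)) hinv
      fun w hw => (hfree w hw).continuousAt)
    (fun t ht => h.hasDerivWithinAt (f := PistonState.X) ht rfl hasDerivAt_X)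
    (fun t ht => h.hasDerivWithinAt (f := fun w => ε * (w.P + G w)) ht (hinv t ht)
      (hfree _ (h.admissible t ⟨ht.1, ht.2.le⟩).impact))
    ?_ ?_ hY ?_ hX0.symm ?_ t₁ ht₁
  · have hnn : 0 ≤ (m + n) * R * ε := by positivity
    constructor
    · have e : ε * (z t₁).P - ε * P t₁ =
        (ε * ((z t₁).P + G (z t₁)) - ε * P t₁) - ε * G (z t₁) := by ring
      rw [e]
      refine (abs_sub _ _).trans ?_
      have h1 : |ε * G (z t₁)| ≤ (m + n) * R * ε := by
        rw [abs_mul, abs_of_pos hε, mul_comm]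
        gcongr
        exact hGle t₁ ht₁
      rw [add_mul _ _ ε]
      exact add_le_add hmain.2 h1
    · rw [add_mul _ _ ε]
      linarith [hmain.1]
  · intro t ht
    have htI : t ∈ Icc 0 s := ⟨ht.1, ht.2.le⟩
    -- By continuity the corrected momentum may be taken after the impact; the velocity is then `ε ^
    -- 2 * P`, and only the corrector remains.
    have e : ((z t).impact (1 / ε ^ 2) L).P / (1 / ε ^ 2) - ε * (ε * ((z t).P + G (z t))) =
        -(ε ^ 2 * G ((z t).impact (1 / ε ^ 2) L)) := by
      rw [← hinv t ht]
      field_simp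
      ring
    have hb : |G ((z t).impact (1 / ε ^ 2) L)| ≤ (m + n) * R := by
      have hp := abs_le_of_energy_le hM0 hR (hEt t htI _ (Or.inr ⟨ht.2, rfl⟩))
      have had := (h.admissible t htI).impact (M := 1 / ε ^ 2)
      have a1 := had.abs_virialLeft_le hp.1
      have a2 := had.abs_virialRight_le hp.2.1
      refine (abs_add_le _ _).trans ?_
      linarith
    rw [e, abs_neg, abs_mul, abs_of_nonneg (sq_nonneg ε), mul_comm]
    gcongr
    refine hb.trans (le_add_of_nonneg_right (by positivity))
  · intro t ht
    have htI : t ∈ Icc 0 s := ⟨ht.1, ht.2.le⟩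
    set w := (z t).impact (1 / ε ^ 2) L with hw
    have hwE := hEt t htI w (Or.inr ⟨ht.2, rfl⟩)
    have hp := abs_le_of_energy_le hM0 hR hwE
    have hV := abs_velocity_le_mul hε hR hwE
    have hVR : ε * R ≤ R := mul_le_of_le_one_left hR hε1
    have had : w.Admissible L := (h.admissible t htI).impact
    have hx := hX t htI
    have hwX : (z t).X = w.X := rfl
    have ha := hA t htI w (Or.inr ⟨ht.2, rfl⟩)
    have f1 := had.abs_forceLeft_sub_le hδ (hwX ▸ hx.1.le) hp.1 hV hVR ha.1
    have f2 := had.abs_forceRight_sub_le hδ (by rw [← hwX]; linarith [hx.2]) hp.2.1 hV hVR ha.2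
    rw [truncatedForce_eq hx.1.le hx.2.le, ← mul_sub, abs_mul, abs_of_pos hε]
    have e : 0 + (w.forceLeft (1 / ε ^ 2) + -w.forceRight (1 / ε ^ 2) L) -
        (α / (z t).X ^ 3 - β / (L - (z t).X) ^ 3) =
        (w.forceLeft (1 / ε ^ 2) - α / w.X ^ 3) -
          (w.forceRight (1 / ε ^ 2) L - β / (L - w.X) ^ 3) := by rw [hwX]; ring
    rw [e]
    have h1 := (abs_sub _ _).trans (add_le_add f1 f2)
    have h2 : (m * (2 * R * L ^ 2 * (ε * R)) + D * ε) / δ ^ 3 +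
        (n * (2 * R * L ^ 2 * (ε * R)) + D * ε) / δ ^ 3 =
        ((m + n) * (2 * R * L ^ 2 * R) + 2 * D) / δ ^ 3 * ε := by ring
    rw [h2] at h1
    have h3 : 0 ≤ (m + n) * R * ε := by positivity
    calc _ ≤ ε * (((m + n) * (2 * R * L ^ 2 * R) + 2 * D) / δ ^ 3 * ε) := by gcongr
      _ ≤ ε * (((m + n) * R + ((m + n) * (2 * R * L ^ 2 * R) + 2 * D) / δ ^ 3) * ε) := by
        gcongr
        exact le_add_of_nonneg_left (by positivity)
      _ = _ := by ring
  · intro t ht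
    rw [truncatedForce_eq (hYmem t ht).1 (hYmem t ht).2]
    exact hW t ht
  · have e : ε * ((z 0).P + G (z 0)) - ε * P 0 = ε * G (z 0) := by rw [hP0]; ring
    simp only [e, abs_mul, abs_of_pos hε]
    rw [mul_comm]
    gcongr
    exact hGle 0 ⟨le_rfl, ht₁.1.trans ht₁.2⟩

theorem pi_sq_mul_sum_actionLeft (z : PistonState m n) :
    Real.pi ^ 2 * ∑ i, z.actionLeft i ^ 2 = z.X ^ 2 * ∑ i, z.pl i ^ 2 := by
  rw [Finset.mul_sum, Finset.mul_sum]
  refine Finset.sum_congr rfl fun i _ => ?_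
  have := Real.pi_ne_zero
  unfold actionLeft
  field_simp
  rw [sq_abs, mul_comm]

theorem pi_sq_mul_sum_actionRight (L : ℝ) (z : PistonState m n) :
    Real.pi ^ 2 * ∑ i, z.actionRight L i ^ 2 = (L - z.X) ^ 2 * ∑ i, z.pr i ^ 2 := by
  rw [Finset.mul_sum, Finset.mul_sum]
  refine Finset.sum_congr rfl fun i _ => ?_
  have := Real.pi_ne_zero
  unfold actionRight
  field_simp
  rw [sq_abs, mul_comm]

end PistonState

end

/-! ### Choice of the constants and conclusion. -/

open PistonState in
theorem mainTheorem8 (m n : ℕ) (L T a b : ℝ) (hL : 0 < L) (hT : 0 < T) (ha : 0 < a) :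
    ∃ ε₀ > 0, ∃ C > 0, ∀ ε : ℝ, 0 < ε → ε < ε₀ →
      ∀ z₀ : PistonState m n, z₀.Admissible L →
        a ≤ z₀.X → z₀.X ≤ L - a → |ε * z₀.P| ≤ b →
        a ≤ ∑ i, z₀.pl i ^ 2 → ∑ i, z₀.pl i ^ 2 ≤ b →
        a ≤ ∑ j, z₀.pr j ^ 2 → ∑ j, z₀.pr j ^ 2 ≤ b →
        (∃ P X : ℝ → ℝ, P 0 = z₀.P ∧ X 0 = z₀.X ∧
          IsAveragedMotion ε L (∑ i, z₀.actionLeft i ^ 2) (∑ j, z₀.actionRight L j ^ 2)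
            (T / ε) P X) ∧
        ∀ s : ℝ, 0 ≤ s → s ≤ T / ε →
          ∀ z : ℝ → PistonState m n, z 0 = z₀ → PistonState.IsMotion (1 / ε ^ 2) L s z →
          ∀ P X : ℝ → ℝ, P 0 = z₀.P → X 0 = z₀.X →
            IsAveragedMotion ε L (∑ i, z₀.actionLeft i ^ 2) (∑ j, z₀.actionRight L j ^ 2) s P X →
            ∀ t ∈ Icc 0 s,
              |ε * (z t).P - ε * P t| ≤ C * ε ∧ |(z t).X - X t| ≤ C * ε := by
  -- Twice the energy is at most `b ^ 2 + 2 * b ≤ R ^ 2`. The sign of `b` is known only once an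
  -- initial state is given, hence `|b|`.
  set R : ℝ := |b| + 1 with hRdef
  have hR : 0 < R := by positivity
  set N : ℝ := m + n with hN
  have hN0 : 0 ≤ N := by positivity
  -- One `δ` with `δ ^ 2 * q < a ^ 3` serves both confinements: `δ ^ 2 * R ^ 2 < a ^ 3` for the
  -- averaged system, and `N * (2 * δ * R) ^ 2 < a ^ 3 / 2` for the exact one.
  set q : ℝ := 16 * (N + 1) * R ^ 2 with hq
  have hq0 : 0 < q := by positivity
  obtain ⟨δ, hδ, hδa, hδq⟩ : ∃ δ : ℝ, 0 < δ ∧ δ < a ∧ δ ^ 2 * q < a ^ 3 := by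
    have h1 : Tendsto (fun δ : ℝ => δ ^ 2 * q) (𝓝[>] 0) (𝓝 0) := by
      have : ContinuousAt (fun δ : ℝ => δ ^ 2 * q) 0 := by fun_prop
      simpa using this.tendsto.mono_left nhdsWithin_le_nhds
    obtain ⟨δ, h2, h3⟩ := ((h1.eventually (gt_mem_nhds (pow_pos ha 3))).and
      (Ioo_mem_nhdsGT ha)).exists
    exact ⟨δ, h3.1, h3.2, h2⟩
  -- In units of `ε`: the drift of the invariants, plus their initial distance from `π ^ 2` times
  -- the sums of squared actions.
  set D : ℝ := driftBound m n R L δ T + impactConst m n R L * R with hDdef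
  have hκ := impactConst_nonneg (m := m) (n := n) (L := L) hR.le
  have hdrift0 : 0 ≤ driftBound m n R L δ T := by unfold driftBound; positivity
  have hD : 0 ≤ D := by positivity
  -- `ε ≤ 1` gives `M ≥ 1`. The second bound gives `D * ε < a ^ 3 / 2`, so the drift uses up at most
  -- half of the lower bound `a ^ 3` of `π ^ 2 * A` and `π ^ 2 * B`; `δ` is chosen to fit in the
  -- other half. In `C`, `L ^ 2 * R ^ 2` is an upper bound of both, and the last `+ 1` ensures
  -- positivity.
  refine ⟨min 1 (a ^ 3 / (2 * (D + 1))), by positivity,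
    ((m + n) * R + ((m + n) * R + ((m + n) * (2 * R * L ^ 2 * R) + 2 * D) / δ ^ 3)) *
      Real.exp ((1 + 6 * (L ^ 2 * R ^ 2) / δ ^ 4) * T) + (m + n) * R + 1, by positivity, ?_⟩
  intro ε hε hε₀ z₀ had hX1 hX2 hP hl1 hl2 hr1 hr2
  have hε1 : ε ≤ 1 := (hε₀.le.trans (min_le_left _ _))
  have hεD : D * ε < a ^ 3 / 2 := by
    have h1 : ε < a ^ 3 / (2 * (D + 1)) := hε₀.trans_le (min_le_right _ _)
    rw [lt_div_iff₀ (by positivity)] at h1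
    linarith
  have hb : 0 ≤ b := (abs_nonneg _).trans hP
  have hRb : R = b + 1 := by rw [hRdef, abs_of_nonneg hb]
  have hM1 : 1 ≤ 1 / ε ^ 2 := by
    rw [le_div_iff₀ (by positivity), one_mul]; exact pow_le_one₀ hε.le hε1
  have hEeq : z₀.energy (1 / ε ^ 2) =
      (ε * z₀.P) ^ 2 + ∑ i, z₀.pl i ^ 2 + ∑ j, z₀.pr j ^ 2 := by
    unfold energy; congr 2; field_simp
  have hP2 : (ε * z₀.P) ^ 2 ≤ b ^ 2 := sq_le_sq' (abs_le.1 hP).1 (abs_le.1 hP).2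
  have hE : z₀.energy (1 / ε ^ 2) ≤ R ^ 2 := by rw [hEeq, hRb]; linarith [add_sq b 1]
  set A := ∑ i, z₀.actionLeft i ^ 2 with hA
  set B := ∑ j, z₀.actionRight L j ^ 2 with hB
  have hα := pi_sq_mul_sum_actionLeft z₀
  have hβ := pi_sq_mul_sum_actionRight L z₀
  rw [← hA] at hα
  rw [← hB] at hβ
  have hX0 := had.1
  have hX0' : 0 < L - z₀.X := sub_pos.2 had.2.1
  have hbR : b ≤ R ^ 2 := by rw [hRb]; linarith [add_sq b 1, sq_nonneg b]
  have hαa : a ^ 3 ≤ Real.pi ^ 2 * A := by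
    rw [hα]
    calc a ^ 3 = a ^ 2 * a := by ring
      _ ≤ _ := by gcongr
  have hβa : a ^ 3 ≤ Real.pi ^ 2 * B := by
    rw [hβ]
    have : a ≤ L - z₀.X := by linarith
    calc a ^ 3 = a ^ 2 * a := by ring
      _ ≤ _ := by gcongr
  have hαΓ : Real.pi ^ 2 * A ≤ L ^ 2 * R ^ 2 := by
    rw [hα]
    gcongr
    exacts [had.2.1.le, hl2.trans hbR]
  have hβΓ : Real.pi ^ 2 * B ≤ L ^ 2 * R ^ 2 := by
    rw [hβ]
    gcongr
    exacts [by linarith, hr2.trans hbR]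
  have ha3 : 0 < a ^ 3 := by positivity
  have hNR : 0 ≤ N * R ^ 2 := by positivity
  have hδR : δ ^ 2 * R ^ 2 < a ^ 3 := by
    refine lt_of_le_of_lt ?_ hδq
    rw [hq]; gcongr; linarith [sq_nonneg R]
  have hH0 : (ε * z₀.P) ^ 2 + Real.pi ^ 2 * A / z₀.X ^ 2 +
      Real.pi ^ 2 * B / (L - z₀.X) ^ 2 ≤ R ^ 2 := by
    rw [hα, hβ, mul_div_cancel_left₀ _ (by positivity), mul_div_cancel_left₀ _ (by positivity),
      ← hEeq]
    exact hE
  have hαδ := hδR.trans_le hαa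
  have hβδ := hδR.trans_le hβa
  refine ⟨?_, ?_⟩
  · obtain ⟨X, W, hX, hW, h1, h2, h3⟩ := exists_averaged_solution (τ := T / ε) hε hδ hR
      (by positivity) hαδ hβδ ⟨had.1, had.2.1⟩ hH0
    refine ⟨fun t => ε⁻¹ * W t, X, by simp [hW, hε.ne'], hX, ?_⟩
    rw [isAveragedMotion_iff hε]
    simp only [mul_inv_cancel_left₀ hε.ne']
    exact ⟨h1, h2, h3⟩
  intro s hs hsT z hz h P X hP0 hX0 hav
  subst hz
  rw [isAveragedMotion_iff hε] at hav
  obtain ⟨hmem, hdX, hdP⟩ := hav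
  have hp := abs_le_of_energy_le (by positivity) hR.le hE
  have hV := abs_velocity_le_mul hε hR.le hE
  have hVR : ε * R ≤ R := mul_le_of_le_one_left hR.le hε1
  have hκl : (m : ℝ) * (4 * R * L ^ 2 * (ε * R)) ≤ impactConst m n R L * R * ε := by
    calc (m : ℝ) * (4 * R * L ^ 2 * (ε * R)) ≤ (m + n) * (4 * R * L ^ 2 * (ε * R)) := by
          gcongr; simp
      _ = _ := by unfold impactConst; ring
  have hκr : (n : ℝ) * (4 * R * L ^ 2 * (ε * R)) ≤ impactConst m n R L * R * ε := by
    calc (n : ℝ) * (4 * R * L ^ 2 * (ε * R)) ≤ (m + n) * (4 * R * L ^ 2 * (ε * R)) := by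
          gcongr; simp
      _ = _ := by unfold impactConst; ring
  have il := (had.abs_adiabaticLeft_sub_le hp.1 hV hVR).trans hκl
  have ir := (had.abs_adiabaticRight_sub_le hp.2.1 hV hVR).trans hκr
  have hds : driftBound m n R L δ s / (1 / ε ^ 2) ≤ driftBound m n R L δ T * ε := by
    -- Dividing by `M` multiplies by `ε ^ 2`: the part linear in time becomes `T * ε`, and the
    -- constant part gains a spare factor `ε ≤ 1`.
    refine (div_le_div_of_nonneg_right (driftBound_mono hR.le hδ hsT) (by positivity)).trans ?_
    have e : driftBound m n R L δ (T / ε) / (1 / ε ^ 2) =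
        (impactConst m n R L * (2 * ((m + n) * R)) * ε +
        (impactConst m n R L * ((m + n) * (2 * R ^ 2 / δ)) + 1) * T) * ε := by
      unfold driftBound; field_simp
    rw [e]
    unfold driftBound
    refine mul_le_mul_of_nonneg_right (add_le_add ?_ le_rfl) hε.le
    exact mul_le_of_le_one_right (by positivity) hε1
  have hDε : D * ε = driftBound m n R L δ T * ε + impactConst m n R L * R * ε := by
    rw [hDdef]; ring
  have hsmall : ∀ k : ℕ, (k : ℝ) ≤ N → k * (δ * (2 * R)) ^ 2 < a ^ 3 / 2 := by
    intro k hk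
    have h1 : k * (δ * (2 * R)) ^ 2 ≤ N * (δ * (2 * R)) ^ 2 := by gcongr
    have h2 : 0 < (δ * R) ^ 2 := by positivity
    have h3 : 0 ≤ N * (δ * R) ^ 2 := by positivity
    rw [hq] at hδq
    linarith
  have hmemz := h.mem_Ioo hM1 hR hδ hE ⟨by linarith, by linarith⟩
    (by linarith [hsmall m (by simp [hN]), (abs_le.1 il).1])
    (by linarith [hsmall n (by simp [hN]), (abs_le.1 ir).1])
  have hdrift := h.abs_adiabatic_sub_le hM1 hR.le hδ hE
    (fun t ht => ⟨(hmemz t ht).1.le, (hmemz t ht).2.le⟩)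
  have hen := averaged_energy_eq hmem hdX hdP
  have hY : ∀ t ∈ Icc 0 s, δ ≤ X t ∧ X t ≤ L - δ := by
    intro t ht
    have h1 := hen t ht
    rw [hP0, hX0] at h1
    have := averaged_bounds hδ hR hαδ hβδ (hmem t ht) (h1.trans_le hH0)
    exact ⟨this.1.le, this.2.1.le⟩
  intro t ht
  have hfin := h.abs_sub_averaged_le hε hε1 hsT hR.le hδ hE hmemz (ha3.le.trans hαa)
    (ha3.le.trans hβa) hαΓ hβΓ hD (fun t ht w hw => ?_) hY hdX hdP hX0 hP0 t ht
  · constructor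
    · refine hfin.1.trans ?_
      exact mul_le_mul_of_nonneg_right (le_add_of_nonneg_right zero_le_one) hε.le
    · refine hfin.2.trans ?_
      exact mul_le_mul_of_nonneg_right (le_add_of_nonneg_right zero_le_one) hε.le
  · have hd := hdrift t ht w hw
    rw [hDε]
    exact ⟨(abs_sub_le _ _ _).trans (add_le_add (hd.1.trans hds) il),
      (abs_sub_le _ _ _).trans (add_le_add (hd.2.trans hds) ir)⟩
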